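/- Let $d\ge 2$, $a\in\mathbb{R}^d$ and $\mathcal{X}=[a,\infty)=\{x\in\mathbb{R}^d:x\ge a\text{ component-wise}\}$. A function $f:\mathcal X\to\mathbb R$ is called orthounimodal about $a$ if it is non-increasing in each coordinate when the other coordinates are held fixed. Let $M>0$, $\gamma\in(0,1)$, let $g_0$ be a positive, finite-valued probability density on $\mathcal{X}$ (with respect to Lebesgue measure) that is orthounimodal about $a$, and put $$\mathcal{F}=\{f:0\le f(x)\le (Mg_0(x))^{1/(1-\gamma)}\ \forall x\in\mathcal{X},\ f\text{ is orthounimodal about }a\text{ on }\mathcal X\},\qquad \mathcal{L}=\{f/g_0:f\in\mathcal{F}\}.$$ Let $0\le m\le l$, let $\phi_0,\dots,\phi_l:\mathcal{X}\to\mathbb{R}$ satisfy $\mathbb{E}_{g_0}|\phi_j(X)|^{1+\delta}<\infty$ for all $j=0,\dots,l$ and some $\delta>0$, and let $\mu_1,\dots,\mu_l\in\mathbb{R}$. Consider $$(\mathcal{P}):\ \sup_{L\in\mathcal{L}}\mathbb{E}_{g_0}[\phi_0(X)L(X)]\quad\text{s.t. } \mathbb{E}_{g_0}[\phi_j(X)L(X)]\le\mu_j\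 (1\le j\le m),\quad \mathbb{E}_{g_0}[\phi_j(X)L(X)]=\mu_j\ (m<j\le l),$$ and, for points $X_1,\dots,X_n\in\mathcal X$, the sample average problem $$(\mathcal{P}_n):\ \sup_{L\in\mathcal{L}}\frac1n\sum_{i=1}^n\phi_0(X_i)L(X_i)\quad\text{s.t. } \frac1n\sum_{i=1}^n\phi_j(X_i)L(X_i)\le\mu_j\ (1\le j\le m),\quad \frac1n\sum_{i=1}^n\phi_j(X_i)L(X_i)=\mu_j\ (m<j\le l).$$ Optimal values $val(\cdot)$ are taken in $[-\infty,\infty]$, with value $-\infty$ for an infeasible problem. Assume the Slater condition: there is $L_0\in\mathcal{L}$ with $\mathbb{E}_{g_0}[\phi_jL_0]<\mu_j$ for $1\le j\le m$ and $\mathbb{E}_{g_0}[\phi_jL_0]=\mu_j$ for $m<j\le l$, and $(\mu_{m+1},\dots,\mu_l)$ is an interior point of $\{(\mathbb{E}_{g_0}[\phi_{m+1}L],\dots,\mathbb{E}_{g_0}[\phi_lL]):L\in\mathcal{L}\}$. Then: (i) For every $n\ge1$ and every realization $X_1,\dots,X_n\in\mathcal{X}$, $(\mathcal{P}_n)$ is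 equivalent to the linear program $(\mathcal{P}_n')$ in the $n$ variables $L(X_1),\dots,L(X_n)$ that has the same objective and the same moment constraints as $(\mathcal{P}_n)$, with $L\in\mathcal{L}$ replaced by $$L(X_i)g_0(X_i)\le L(X_j)g_0(X_j)\ \text{ if }X_i\ge X_j\text{ component-wise},\qquad 0\le L(X_i)g_0(X_i)\le(Mg_0(X_i))^{1/(1-\gamma)},\ i=1,\dots,n.$$ That is, the vectors satisfying this discrete shape constraint are exactly the vectors $(L(X_1),\dots,L(X_n))$ with $L\in\mathcal{L}$; the feasible points of $(\mathcal P_n')$ are exactly the vectors $(L(X_1),\dots,L(X_n))$ with $L$ feasible for $(\mathcal P_n)$; and the objectives and the optimal values agree. (ii) If $X_1,X_2,\dots$ are i.i.d. with density $g_0$, then $|val(\mathcal{P}_n)-val(\mathcal{P})|\to0$ outer almost surely, i.e. the minimal measurable majorants of $|val(\mathcal{P}_n)-val(\mathcal{P})|$ converge to $0$ almost surely. -/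

import Mathlib

open MeasureTheory ProbabilityTheory Filter Topology
open scoped ENNReal

namespace IWSAA

noncomputable section

/-- `f`, defined on a domain `S ⊆ ℝ^d`, is orthounimodal about `c`: along every coordinate `i`, with
the other coordinates held fixed, it is non-decreasing up to `c i` and non-increasing from `c i` on.
The order on `Fin d → ℝ`, and on its subsets, is the component-wise one. -/
def OrthounimodalAbout {d : ℕ} (c : Fin d → ℝ) {S : Set (Fin d → ℝ)} (f : S → ℝ) : Prop :=
  ∀ (i : Fin d) (x y : S), (∀ j, j ≠ i → x.1 j = y.1 j) →
    (x.1 i ≤ y.1 i → y.1 i ≤ c i → f x ≤ f y) ∧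
    (c i ≤ x.1 i → x.1 i ≤ y.1 i → f y ≤ f x)

/-- The class of functions `f` on `[a, ∞)`, orthounimodal about `a`, with
`0 ≤ f ≤ (M g₀)^(1/(1-γ))`. -/
def shapeClass {d : ℕ} (a : Fin d → ℝ) (M γ : ℝ) (g₀ : Set.Ici a → ℝ) : Set (Set.Ici a → ℝ) :=
  {f | (∀ x, 0 ≤ f x ∧ f x ≤ (M * g₀ x) ^ (1 / (1 - γ))) ∧ OrthounimodalAbout a f}

/-- The likelihood ratios `f / g` of the functions `f` in a class `F`. -/
def likelihoodRatios {S : Type*} (F : Set (S → ℝ)) (g : S → ℝ) : Set (S → ℝ) :=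
  {L | ∃ f ∈ F, ∀ x, L x = f x / g x}

/-- Lebesgue measure on the (measurable) subset `S ⊆ ℝ^d`. -/
def lebesgueOn {d : ℕ} (S : Set (Fin d → ℝ)) : Measure S :=
  (volume : Measure (Fin d → ℝ)).comap Subtype.val

/-- The law with Lebesgue density `g` on the (measurable) subset `S ⊆ ℝ^d`. -/
def densityLaw {d : ℕ} {S : Set (Fin d → ℝ)} (g : S → ℝ) : Measure S :=
  (lebesgueOn S).withDensity fun x => ENNReal.ofReal (g x)

/-- Data of a moment problem on `S`: the objective function `φ₀`, the functions and right-hand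
sides of `m` inequality constraints and of `p` equality constraints. -/
structure MomentData (S : Type*) (m p : ℕ) where
  φ₀ : S → ℝ
  φI : Fin m → S → ℝ
  μI : Fin m → ℝ
  φE : Fin p → S → ℝ
  μE : Fin p → ℝ

/-- Expectation under a law `P`. -/
def expect {S : Type*} [MeasurableSpace S] (P : Measure S) (h : S → ℝ) : ℝ := ∫ x, h x ∂P

/-- Sample average over the points `x 0, …, x (n - 1)`. -/
def sampleMean {S : Type*} {n : ℕ} (x : Fin n → S) (h : S → ℝ) : ℝ :=
  (1 / (n : ℝ)) * ∑ i, h (x i)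

namespace MomentData

variable {S : Type*} {m p : ℕ}

/-- The objective `E[φ₀ L]`, where `E` is an expectation or a sample average. -/
def objective (D : MomentData S m p) (E : (S → ℝ) → ℝ) (L : S → ℝ) : ℝ :=
  E fun x => D.φ₀ x * L x

/-- The feasible set: `L ∈ 𝓛`, `E[φ_j L] ≤ μ_j` for the inequality constraints and
`E[φ_j L] = μ_j` for the equality constraints. -/
def feasible (D : MomentData S m p) (E : (S → ℝ) → ℝ) (𝓛 : Set (S → ℝ)) : Set (S → ℝ) :=
  {L | L ∈ 𝓛 ∧ (∀ j, E (fun x => D.φI j x * L x) ≤ D.μI j) ∧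
    (∀ j, E (fun x => D.φE j x * L x) = D.μE j)}

/-- The optimal value, in the extended reals (`-∞` for an infeasible problem). -/
def val (D : MomentData S m p) (E : (S → ℝ) → ℝ) (𝓛 : Set (S → ℝ)) : EReal :=
  ⨆ L ∈ D.feasible E 𝓛, ((D.objective E L : ℝ) : EReal)

/-- The Slater condition: some feasible `L₀` satisfies the inequality constraints strictly, and the
vector of right-hand sides of the equality constraints is an interior point of the set of
attainable vectors of equality moments. -/
def Slater (D : MomentData S m p) (E : (S → ℝ) → ℝ) (𝓛 : Set (S → ℝ)) : Prop :=
  (∃ L₀ ∈ 𝓛, (∀ j, E (fun x => D.φI j x * L₀ x) < D.μI j) ∧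
    (∀ j, E (fun x => D.φE j x * L₀ x) = D.μE j)) ∧
  D.μE ∈ interior {v : Fin p → ℝ | ∃ L ∈ 𝓛, ∀ j, v j = E fun x => D.φE j x * L x}

end MomentData

/-- A (finite) linear program: maximize `c ⬝ y` subject to `A y ≤ b` and `B y = e`. -/
structure LinearProgram (V I J : Type*) [Fintype V] [Finite I] [Finite J] where
  c : V → ℝ
  A : Matrix I V ℝ
  b : I → ℝ
  B : Matrix J V ℝ
  e : J → ℝ

namespace LinearProgram

variable {V I J : Type*} [Fintype V] [Finite I] [Finite J]

def objective (Q : LinearProgram V I J) (y : V → ℝ) : ℝ := Q.c ⬝ᵥ y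

def feasible (Q : LinearProgram V I J) : Set (V → ℝ) :=
  {y | (∀ i, (Q.A.mulVec y) i ≤ Q.b i) ∧ (∀ j, (Q.B.mulVec y) j = Q.e j)}

def val (Q : LinearProgram V I J) : EReal :=
  ⨆ y ∈ Q.feasible, ((Q.objective y : ℝ) : EReal)

end LinearProgram

/-- The discrete shape constraint on the values `y i` of the likelihood ratio at the points `x i`:
`y i g₀(x i) ≤ y j g₀(x j)` whenever `x i ≥ x j` component-wise, and
`0 ≤ y i g₀(x i) ≤ (M g₀(x i))^(1/(1-γ))`. -/
def discreteShape {d n : ℕ} {a : Fin d → ℝ} (M γ : ℝ) (g₀ : Set.Ici a → ℝ)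
    (x : Fin n → Set.Ici a) : Set (Fin n → ℝ) :=
  {y | (∀ i j, x j ≤ x i → y i * g₀ (x i) ≤ y j * g₀ (x j)) ∧
    ∀ i, 0 ≤ y i * g₀ (x i) ∧ y i * g₀ (x i) ≤ (M * g₀ (x i)) ^ (1 / (1 - γ))}

/-- Labels of the linear inequalities of the reduced problem: the moment inequalities, the order
constraints, the lower bounds, the upper bounds. -/
abbrev IneqIndex {d n : ℕ} {a : Fin d → ℝ} (m : ℕ) (x : Fin n → Set.Ici a) : Type :=
  Fin m ⊕ ({q : Fin n × Fin n // x q.2 ≤ x q.1} ⊕ (Fin n ⊕ Fin n))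

/-- The linear program in the `n` variables `y i = L(x i)` whose constraints are the sample moment
constraints and the discrete shape constraint. -/
def reducedLP {d n m p : ℕ} {a : Fin d → ℝ} (D : MomentData (Set.Ici a) m p) (M γ : ℝ)
    (g₀ : Set.Ici a → ℝ) (x : Fin n → Set.Ici a) :
    LinearProgram (Fin n) (IneqIndex m x) (Fin p) where
  c := fun i => (1 / (n : ℝ)) * D.φ₀ (x i)
  A := Sum.elim (fun j i => (1 / (n : ℝ)) * D.φI j (x i))
    (Sum.elim (fun q => Pi.single q.1.1 (g₀ (x q.1.1)) - Pi.single q.1.2 (g₀ (x q.1.2)))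
      (Sum.elim (fun i => -Pi.single i (g₀ (x i))) (fun i => Pi.single i (g₀ (x i)))))
  b := Sum.elim D.μI (Sum.elim (fun _ => 0)
    (Sum.elim (fun _ => 0) (fun i => (M * g₀ (x i)) ^ (1 / (1 - γ)))))
  B := fun j i => (1 / (n : ℝ)) * D.φE j (x i)
  e := D.μE

/-- The constraints of `reducedLP`, written out. -/
theorem mem_reducedLP_feasible_iff {d n m p : ℕ} {a : Fin d → ℝ}
    (D : MomentData (Set.Ici a) m p) (M γ : ℝ) (g₀ : Set.Ici a → ℝ) (x : Fin n → Set.Ici a)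
    (y : Fin n → ℝ) :
    y ∈ (reducedLP D M γ g₀ x).feasible ↔
      (∀ j, (1 / (n : ℝ)) * ∑ i, D.φI j (x i) * y i ≤ D.μI j) ∧
      (∀ j, (1 / (n : ℝ)) * ∑ i, D.φE j (x i) * y i = D.μE j) ∧
      y ∈ discreteShape M γ g₀ x := by
  simp only [LinearProgram.feasible, reducedLP, discreteShape, Set.mem_ofPred_eq, Matrix.mulVec,
    Sum.forall, Sum.elim_inl, Sum.elim_inr, Subtype.forall, Prod.forall, sub_dotProduct,
    neg_dotProduct, single_dotProduct]
  simp only [dotProduct, mul_assoc, ← Finset.mul_sum, mul_comm (g₀ _), sub_nonpos,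
    Left.neg_nonpos_iff]
  constructor
  · rintro ⟨⟨h1, h2, h3, h4⟩, h5⟩
    exact ⟨h1, h5, h2, fun i => ⟨h3 i, h4 i⟩⟩
  · rintro ⟨h1, h5, h2, h3⟩
    exact ⟨⟨h1, h2, fun i => (h3 i).1, fun i => (h3 i).2⟩, h5⟩

/-- `U` is a minimal measurable majorant of the (arbitrary) map `T`. -/
def IsMinMeasurableMajorant {Ω : Type*} [MeasurableSpace Ω] (P : Measure Ω) (T U : Ω → ℝ≥0∞) :
    Prop :=
  Measurable U ∧ (∀ ω, T ω ≤ U ω) ∧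
    ∀ V : Ω → ℝ≥0∞, Measurable V → (∀ᵐ ω ∂P, T ω ≤ V ω) → ∀ᵐ ω ∂P, U ω ≤ V ω

/-- Outer almost sure convergence of the extended-real maps `Y n` to the constant `c`: the minimal
measurable majorants of `|Y n - c|` converge to `0` almost surely. -/
def OuterASTendsto {Ω : Type*} [MeasurableSpace Ω] (P : Measure Ω) (Y : ℕ → Ω → EReal)
    (c : EReal) : Prop :=
  ∃ U : ℕ → Ω → ℝ≥0∞, (∀ n, IsMinMeasurableMajorant P (fun ω => (Y n ω - c).abs) (U n)) ∧
    ∀ᵐ ω ∂P, Tendsto (fun n => U n ω) atTop (𝓝 0)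

end

end IWSAA

namespace IWSAA

/-! On `[a, ∞)`, orthounimodality about `a` is antitonicity for the component-wise order. The
reduction to a linear program is then an extension statement (`exists_antitone_extension`): give a
point `s` the largest prescribed value among the sample points above `s`.

For convergence, the likelihood ratios share one bound (`likelihoodRatio_le`), so integrable `φ`
have uniformly bounded moments. The heart is a uniform law of large numbers by bracketing
(`exists_finset_uniform`). On a large box `φ L = (φ / g₀) f` with `f` antitone, so on each grid cell
`f` lies between its values at two opposite corners. The corner differences telescope along
diagonals: their sum over the `N ^ d` cells is of order `N ^ (d - 1)`, while a cell has mass of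
order `N ^ (-d)`. Hence closeness of finitely many sample means forces closeness of all moments at
once.

The value is stable under uniformly small changes of the moment operator (`exists_val_sub_abs_le`):
mixing with a Slater point restores the inequalities, and mixing with a point of suitable equality
moments cancels the defect in the equalities. The values need not be measurable, but the events on
which finitely many sample means are close are null measurable, which is enough to control the
minimal majorants (`outerASTendsto_of_forall_pos`). -/

/-! ### Antitone functions and the reduction to a linear program -/

theorem orthounimodalAbout_self_iff_antitone {d : ℕ} {a : Fin d → ℝ} {f : Set.Ici a → ℝ} :
    OrthounimodalAbout a f ↔ Antitone f := by
  classical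
  constructor
  · intro hf x y hxy
    -- Pass from `x` to `y` one coordinate at a time; every intermediate point stays in the domain.
    let z : Finset (Fin d) → Set.Ici a := fun s => ⟨fun i => if i ∈ s then y.1 i else x.1 i,
      fun i => by
        by_cases hi : i ∈ s
        · simpa [hi] using y.2 i
        · simpa [hi] using x.2 i⟩
    have key : ∀ s, f (z s) ≤ f x := by
      intro s
      induction s using Finset.induction_on with
      | empty => exact le_of_eq (congrArg f (Subtype.ext (by simp [z])))
      | insert i s hi ih =>
        refine le_trans ((hf i (z s) (z (insert i s)) ?_).2 ((z s).2 i) ?_) ih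
        · intro j hj
          simp [z, Finset.mem_insert, hj]
        · simpa [z, hi] using hxy i
    have hy : z Finset.univ = y := Subtype.ext (by simp [z])
    exact hy ▸ key Finset.univ
  · intro hf i x y hxy
    refine ⟨fun h1 h2 => ?_, fun _ h2 => hf ?_⟩
    -- The non-decreasing half is void: `y i ≤ a i` forces both `i`-th coordinates to equal `a i`.
    · refine le_of_eq (congrArg f (Subtype.ext (funext fun j => ?_)))
      by_cases hj : j = i
      · subst hj
        exact le_antisymm h1 (h2.trans (x.2 j))
      · exact hxy j hj
    · intro j
      by_cases hj : j = i
      · subst hj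
        exact h2
      · exact (hxy j hj).le

theorem antitone_envelope {S : Type*} [Preorder S] {M γ : ℝ} (hM : 0 < M)
    (hγ : γ ∈ Set.Ioo (0 : ℝ) 1) {g₀ : S → ℝ} (hpos : ∀ x, 0 < g₀ x) (hg : Antitone g₀) :
    Antitone fun x => (M * g₀ x) ^ (1 / (1 - γ)) := by
  intro x y hxy
  have h1 : 0 < 1 - γ := by linarith [hγ.2]
  exact Real.rpow_le_rpow (mul_pos hM (hpos y)).le
    (mul_le_mul_of_nonneg_left (hg hxy) hM.le) (by positivity)

/-- Finitely many values that are order-reversing on the points `x i` and dominated by an antitone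
envelope extend to an antitone function below the envelope. -/
theorem exists_antitone_extension {S : Type*} [Preorder S] {n : ℕ} (x : Fin n → S)
    (z : Fin n → ℝ) (B : S → ℝ) (hB : Antitone B) (hB0 : ∀ s, 0 ≤ B s)
    (hz : ∀ i j, x j ≤ x i → z i ≤ z j) (hz0 : ∀ i, 0 ≤ z i) (hzB : ∀ i, z i ≤ B (x i)) :
    ∃ f : S → ℝ, Antitone f ∧ (∀ s, 0 ≤ f s ∧ f s ≤ B s) ∧ ∀ i, f (x i) = z i := by
  classical
  let w : Fin n → NNReal := fun i => ⟨z i, hz0 i⟩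
  -- In `NNReal` an empty supremum is `0`, the right value at points below no sample point.
  let F : S → NNReal := fun s => (Finset.univ.filter fun i => s ≤ x i).sup w
  refine ⟨fun s => F s, ?_, fun s => ⟨(F s).2, ?_⟩, fun i => ?_⟩
  · intro s t hst
    refine NNReal.coe_le_coe.2 (Finset.sup_mono fun i hi => ?_)
    rw [Finset.mem_filter] at hi ⊢
    exact ⟨hi.1, hst.trans hi.2⟩
  · have : F s ≤ ⟨B s, hB0 s⟩ := Finset.sup_le fun i hi =>
      NNReal.coe_le_coe.1 ((hzB i).trans (hB (Finset.mem_filter.1 hi).2))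
    exact NNReal.coe_le_coe.2 this
  · have : F (x i) = w i := le_antisymm
      (Finset.sup_le fun j hj => NNReal.coe_le_coe.1 (hz j i (Finset.mem_filter.1 hj).2))
      (Finset.le_sup (f := w) (by simp))
    exact congrArg NNReal.toReal this

theorem mem_likelihoodRatios_shapeClass_iff {d : ℕ} {a : Fin d → ℝ} {M γ : ℝ}
    {g₀ : Set.Ici a → ℝ} (hpos : ∀ x, 0 < g₀ x) {L : Set.Ici a → ℝ} :
    L ∈ likelihoodRatios (shapeClass a M γ g₀) g₀ ↔
      (∀ x, 0 ≤ L x * g₀ x ∧ L x * g₀ x ≤ (M * g₀ x) ^ (1 / (1 - γ))) ∧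
        Antitone fun x => L x * g₀ x := by
  constructor
  · rintro ⟨f, ⟨hf, hf'⟩, hL⟩
    have : (fun x => L x * g₀ x) = f := funext fun x => by
      rw [hL x, div_mul_cancel₀ _ (hpos x).ne']
    rw [this]
    exact ⟨fun x => by simpa only [← congrFun this x] using hf x,
      orthounimodalAbout_self_iff_antitone.1 hf'⟩
  · rintro ⟨h1, h2⟩
    exact ⟨fun x => L x * g₀ x, ⟨h1, orthounimodalAbout_self_iff_antitone.2 h2⟩,
      fun x => (mul_div_cancel_right₀ _ (hpos x).ne').symm⟩

theorem image_likelihoodRatios_eq_discreteShape {d n : ℕ} {a : Fin d → ℝ} {M γ : ℝ} (hM : 0 < M)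
    (hγ : γ ∈ Set.Ioo (0 : ℝ) 1) {g₀ : Set.Ici a → ℝ} (hpos : ∀ x, 0 < g₀ x) (hg : Antitone g₀)
    (x : Fin n → Set.Ici a) :
    (fun (L : Set.Ici a → ℝ) (i : Fin n) => L (x i)) ''
      likelihoodRatios (shapeClass a M γ g₀) g₀ = discreteShape M γ g₀ x := by
  ext y
  constructor
  · rintro ⟨L, hL, rfl⟩
    rw [mem_likelihoodRatios_shapeClass_iff hpos] at hL
    exact ⟨fun i j hij => hL.2 hij, fun i => hL.1 (x i)⟩
  · rintro ⟨h1, h2⟩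
    obtain ⟨f, hf, hfB, hfx⟩ := exists_antitone_extension x (fun i => y i * g₀ (x i)) _
      (antitone_envelope hM hγ hpos hg) (fun s => Real.rpow_nonneg (mul_pos hM (hpos s)).le _) h1
      (fun i => (h2 i).1) (fun i => (h2 i).2)
    refine ⟨fun s => f s / g₀ s, ⟨f, ⟨hfB, orthounimodalAbout_self_iff_antitone.2 hf⟩,
      fun s => rfl⟩, funext fun i => ?_⟩
    simp only [hfx, mul_div_cancel_right₀ _ (hpos (x i)).ne']

theorem objective_sampleMean_eq {d n m p : ℕ} {a : Fin d → ℝ} (D : MomentData (Set.Ici a) m p)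
    (M γ : ℝ) (g₀ : Set.Ici a → ℝ) (x : Fin n → Set.Ici a) (L : Set.Ici a → ℝ) :
    D.objective (sampleMean x) L = (reducedLP D M γ g₀ x).objective fun i => L (x i) := by
  simp [MomentData.objective, sampleMean, LinearProgram.objective, reducedLP, dotProduct,
    Finset.mul_sum, mul_assoc]

theorem image_feasible_eq {d n m p : ℕ} {a : Fin d → ℝ} {M γ : ℝ} (hM : 0 < M)
    (hγ : γ ∈ Set.Ioo (0 : ℝ) 1) {g₀ : Set.Ici a → ℝ} (hpos : ∀ x, 0 < g₀ x) (hg : Antitone g₀)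
    (D : MomentData (Set.Ici a) m p) (x : Fin n → Set.Ici a) :
    (fun (L : Set.Ici a → ℝ) (i : Fin n) => L (x i)) ''
      D.feasible (sampleMean x) (likelihoodRatios (shapeClass a M γ g₀) g₀)
        = (reducedLP D M γ g₀ x).feasible := by
  ext y
  rw [mem_reducedLP_feasible_iff, ← image_likelihoodRatios_eq_discreteShape hM hγ hpos hg]
  constructor
  · rintro ⟨L, ⟨h1, h2, h3⟩, rfl⟩
    exact ⟨h2, h3, L, h1, rfl⟩
  · rintro ⟨h2, h3, L, h1, rfl⟩
    exact ⟨L, ⟨h1, h2, h3⟩, rfl⟩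

theorem val_sampleMean_eq {d n m p : ℕ} {a : Fin d → ℝ} {M γ : ℝ} (hM : 0 < M)
    (hγ : γ ∈ Set.Ioo (0 : ℝ) 1) {g₀ : Set.Ici a → ℝ} (hpos : ∀ x, 0 < g₀ x) (hg : Antitone g₀)
    (D : MomentData (Set.Ici a) m p) (x : Fin n → Set.Ici a) :
    D.val (sampleMean x) (likelihoodRatios (shapeClass a M γ g₀) g₀)
      = (reducedLP D M γ g₀ x).val := by
  rw [LinearProgram.val, ← image_feasible_eq hM hγ hpos hg, iSup_image]
  simp only [MomentData.val, objective_sampleMean_eq D M γ g₀ x]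

/-! ### Measurability and domination by Lebesgue measure -/

/-- Strict superlevel sets are lower sets, hence order-connected, and order-connected sets in `ι →
ℝ` are null measurable. -/
theorem _root_.Antitone.aemeasurable_pi {ι : Type*} [Fintype ι] {F : (ι → ℝ) → ℝ}
    (hF : Antitone F) : AEMeasurable F := by
  have h : ∀ c, NullMeasurableSet (F ⁻¹' Set.Ioi c) := fun c => by
    have : IsLowerSet (F ⁻¹' Set.Ioi c) := fun x y hyx hx => lt_of_lt_of_le hx (hF hyx)
    exact this.ordConnected.nullMeasurableSet
  have : NullMeasurable F := by
    have hm : @Measurable (NullMeasurableSpace (ι → ℝ) volume) ℝ _ _ F :=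
      measurable_of_Ioi fun c => h c
    exact fun s hs => hm hs
  exact this.aemeasurable

theorem aemeasurable_of_antitone {d : ℕ} {a : Fin d → ℝ} {f : Set.Ici a → ℝ} (hf : Antitone f) :
    AEMeasurable f (lebesgueOn (Set.Ici a)) := by
  -- Precomposing with `x ↦ x ⊔ a` gives an antitone extension to the whole space.
  let F : (Fin d → ℝ) → ℝ := fun x => f ⟨x ⊔ a, Set.mem_Ici.2 le_sup_right⟩
  have hF : Antitone F := fun x y hxy => hf (sup_le_sup_right (α := Fin d → ℝ) hxy a)
  have hfF : f = F ∘ Subtype.val := funext fun x =>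
    congrArg f (Subtype.ext (sup_eq_left.2 x.2).symm)
  have hmp := measurePreserving_subtype_coe (μa := (volume : Measure (Fin d → ℝ)))
    (measurableSet_Ici : MeasurableSet (Set.Ici a))
  rw [hfF]
  refine AEMeasurable.comp_measurable ?_ measurable_subtype_coe
  rw [lebesgueOn, hmp.map_eq]
  exact hF.aemeasurable_pi.restrict

theorem densityLaw_absolutelyContinuous {d : ℕ} {S : Set (Fin d → ℝ)} (g : S → ℝ) :
    densityLaw g ≪ lebesgueOn S :=
  withDensity_absolutelyContinuous _ _

theorem densityLaw_le {d : ℕ} {S : Set (Fin d → ℝ)} {g : S → ℝ} {G : ℝ} (hG : ∀ x, g x ≤ G) :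
    densityLaw g ≤ ENNReal.ofReal G • lebesgueOn S := by
  rw [densityLaw, ← withDensity_const]
  exact withDensity_mono (Eventually.of_forall fun x => ENNReal.ofReal_le_ofReal (hG x))

/-! ### Grids and the oscillation of antitone functions -/

/-- Index of the half-open cell of side `h`, in the grid with origin `a`, that contains `x`. -/
noncomputable def cellIndex {d : ℕ} (a : Fin d → ℝ) (h : ℝ) (x : Set.Ici a) : Fin d → ℕ :=
  fun i => ⌊(x.1 i - a i) / h⌋₊

/-- The vertex with index `k` of the grid of mesh `h` with origin `a`. -/
noncomputable def gridPoint {d : ℕ} (a : Fin d → ℝ) (h : NNReal) (k : Fin d → ℕ) : Set.Ici a :=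
  ⟨fun i => a i + k i * h, fun i => le_add_of_nonneg_right (by positivity)⟩

theorem measurable_cellIndex {d : ℕ} (a : Fin d → ℝ) (h : ℝ) : Measurable (cellIndex a h) := by
  refine measurable_pi_iff.2 fun i => Nat.measurable_floor.comp ?_
  have : Measurable fun x : Set.Ici a => x.1 i := (measurable_pi_apply i).comp measurable_subtype_coe
  exact (this.sub_const _).div_const _

theorem gridPoint_cellIndex_le {d : ℕ} {a : Fin d → ℝ} {h : NNReal} (hh : 0 < h) (x : Set.Ici a) :
    gridPoint a h (cellIndex a h x) ≤ x := by
  intro i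
  have h0 : (0 : ℝ) < h := hh
  have hx : 0 ≤ (x.1 i - a i) / h := div_nonneg (sub_nonneg.2 (x.2 i)) h0.le
  have := Nat.floor_le hx
  rw [le_div_iff₀ h0] at this
  change a i + (⌊(x.1 i - a i) / h⌋₊ : ℝ) * h ≤ x.1 i
  linarith

theorem le_gridPoint_cellIndex {d : ℕ} {a : Fin d → ℝ} {h : NNReal} (hh : 0 < h) (x : Set.Ici a) :
    x ≤ gridPoint a h (cellIndex a h x + 1) := by
  intro i
  have h0 : (0 : ℝ) < h := hh
  have := (Nat.lt_floor_add_one ((x.1 i - a i) / h)).le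
  rw [div_le_iff₀ h0] at this
  change x.1 i ≤ a i + ((⌊(x.1 i - a i) / h⌋₊ + 1 : ℕ) : ℝ) * h
  push_cast
  linarith

theorem lebesgueOn_cell_le {d : ℕ} {a : Fin d → ℝ} {h : NNReal} (hh : 0 < h) (k : Fin d → ℕ) :
    lebesgueOn (Set.Ici a) (cellIndex a h ⁻¹' {k}) ≤ ENNReal.ofReal ((h : ℝ) ^ d) := by
  have h0 : (0 : ℝ) < h := hh
  rw [lebesgueOn, (MeasurableEmbedding.subtype_coe measurableSet_Ici).comap_apply]
  have hsub : Subtype.val '' (cellIndex a h ⁻¹' {k}) ⊆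
      Set.pi Set.univ fun i => Set.Ico (a i + k i * h) (a i + (k i + 1) * h) := by
    rintro _ ⟨x, hx, rfl⟩ i -
    have hk : cellIndex a h x = k := hx
    have h1 := gridPoint_cellIndex_le hh x i
    have h2 := Nat.lt_floor_add_one ((x.1 i - a i) / h)
    rw [div_lt_iff₀ h0] at h2
    have h3 : ⌊(x.1 i - a i) / (h : ℝ)⌋₊ = k i := congrFun hk i
    rw [h3] at h2
    rw [hk] at h1
    exact ⟨h1, by linarith⟩
  refine (measure_mono hsub).trans ?_
  rw [Real.volume_pi_Ico]
  refine le_of_eq ?_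
  have : ∀ i, a i + ((k i : ℝ) + 1) * h - (a i + k i * h) = h := fun i => by ring
  simp only [this, Finset.prod_const, Finset.card_univ, Fintype.card_fin]
  rw [ENNReal.ofReal_pow h0.le]

theorem lt_of_mem_box {d : ℕ} {a : Fin d → ℝ} {ρ N : ℕ} (hN : 0 < N) (hρ : 0 < ρ)
    (x : Set.Ici a) (i : Fin d) :
    cellIndex a ((ρ / N : NNReal) : ℝ) x i < N ↔ x.1 i - a i < ρ := by
  have h1 : (0 : ℝ) < N := Nat.cast_pos.2 hN
  have h2 : (0 : ℝ) < ρ := Nat.cast_pos.2 hρ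
  rw [cellIndex, Nat.floor_lt (div_nonneg (sub_nonneg.2 (x.2 i)) (NNReal.coe_nonneg _))]
  push_cast
  rw [div_lt_iff₀ (by positivity)]
  field_simp

/-- Telescoping along the diagonals of the grid. -/
theorem sum_diagonal_oscillation_le {d N : ℕ} {B : ℝ} (F : (Fin d → ℕ) → ℝ) (hF : ∀ k, 0 ≤ F k)
    (hFB : ∀ k, F k ≤ B) :
    ∑ k ∈ Fintype.piFinset fun _ : Fin d => Finset.range N, (F k - F (k + 1)) ≤
      B * ((N : ℝ) ^ d - ((N - 1 : ℕ) : ℝ) ^ d) := by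
  classical
  set K := Fintype.piFinset fun _ : Fin d => Finset.range N
  set K' := Fintype.piFinset fun _ : Fin d => Finset.range (N - 1)
  have hK' : K' ⊆ K := Fintype.piFinset_subset _ _ fun i => by
    intro j hj
    simp only [Finset.mem_range] at hj ⊢
    omega
  have hinj : Set.InjOn (fun k : Fin d → ℕ => k + 1) (K' : Set (Fin d → ℕ)) :=
    fun k _ k' _ h => add_right_cancel h
  have himg : K'.image (fun k => k + 1) ⊆ K := by
    intro k hk
    obtain ⟨k', hk', rfl⟩ := Finset.mem_image.1 hk
    simp only [K, K', Fintype.mem_piFinset, Finset.mem_range] at hk' ⊢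
    intro i
    have := hk' i
    simp only [Pi.add_apply, Pi.one_apply]
    omega
  -- The terms `F (k + 1)` with `k ∈ K'` cancel against `F` on the shifted cube, and the other terms
  -- `F (k + 1)` are nonnegative. What survives is `F` on the cells outside the shifted cube, each
  -- at most `B`.
  have h1 : ∑ k ∈ K'.image (fun k => k + 1), F k ≤ ∑ k ∈ K, F (k + 1) := by
    rw [Finset.sum_image hinj]
    exact Finset.sum_le_sum_of_subset_of_nonneg hK' fun k _ _ => hF _
  have h2 : ∑ k ∈ K \ K'.image (fun k => k + 1), F k + ∑ k ∈ K'.image (fun k => k + 1), F k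
      = ∑ k ∈ K, F k := Finset.sum_sdiff himg
  have h3 : ∑ k ∈ K \ K'.image (fun k => k + 1), F k ≤
      (K \ K'.image (fun k => k + 1)).card • B :=
    Finset.sum_le_card_nsmul _ _ _ fun k _ => hFB k
  have h4 : ((K \ K'.image (fun k => k + 1)).card : ℝ) = (N : ℝ) ^ d - ((N - 1 : ℕ) : ℝ) ^ d := by
    rw [Finset.card_sdiff_of_subset himg, Nat.cast_sub (Finset.card_le_card himg),
      Finset.card_image_of_injOn hinj]
    simp [K, K']
  rw [nsmul_eq_mul, h4] at h3
  rw [Finset.sum_sub_distrib]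
  linarith

theorem tendsto_pow_sub_pow_div_pow (d : ℕ) :
    Tendsto (fun N : ℕ => ((N : ℝ) ^ d - ((N - 1 : ℕ) : ℝ) ^ d) / (N : ℝ) ^ d) atTop (𝓝 0) := by
  have h : Tendsto (fun N : ℕ => 1 - (1 - 1 / (N : ℝ)) ^ d) atTop (𝓝 (1 - (1 - 0) ^ d)) :=
    tendsto_const_nhds.sub ((tendsto_const_nhds.sub tendsto_one_div_atTop_nhds_zero_nat).pow d)
  simp only [sub_zero, one_pow, sub_self] at h
  refine h.congr' ?_
  filter_upwards [eventually_gt_atTop 0] with N hN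
  have h1 : (0 : ℝ) < N := Nat.cast_pos.2 hN
  rw [Nat.cast_pred hN, sub_div, div_self (by positivity), ← div_pow, sub_div,
    div_self (by positivity)]

/-! ### Sample means and the uniform law of large numbers -/

section SampleMean

variable {S : Type*} {n : ℕ} (x : Fin n → S)

theorem sampleMean_mono {f g : S → ℝ} (h : ∀ s, f s ≤ g s) : sampleMean x f ≤ sampleMean x g :=
  mul_le_mul_of_nonneg_left (Finset.sum_le_sum fun i _ => h (x i)) (by positivity)

theorem sampleMean_add (f g : S → ℝ) :
    sampleMean x (fun s => f s + g s) = sampleMean x f + sampleMean x g := by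
  simp [sampleMean, Finset.sum_add_distrib, mul_add]

theorem sampleMean_sub (f g : S → ℝ) :
    sampleMean x (fun s => f s - g s) = sampleMean x f - sampleMean x g := by
  simp [sampleMean, Finset.sum_sub_distrib, mul_sub]

theorem sampleMean_const_mul (c : ℝ) (f : S → ℝ) :
    sampleMean x (fun s => c * f s) = c * sampleMean x f := by
  simp only [sampleMean, ← Finset.mul_sum]
  ring

theorem sampleMean_sum {κ : Type*} (K : Finset κ) (f : κ → S → ℝ) :
    sampleMean x (fun s => ∑ k ∈ K, f k s) = ∑ k ∈ K, sampleMean x (f k) := by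
  simp only [sampleMean, ← Finset.mul_sum]
  rw [Finset.sum_comm]

end SampleMean

theorem tendsto_integral_posPart_sub_nat {S : Type*} [MeasurableSpace S] {P : Measure S}
    {w : S → ℝ} (hw : Integrable w P) (hw0 : ∀ x, 0 ≤ w x) :
    Tendsto (fun R : ℕ => ∫ x, max (w x - R) 0 ∂P) atTop (𝓝 0) := by
  have := tendsto_integral_of_dominated_convergence (μ := P)
    (F := fun (R : ℕ) x => max (w x - R) 0) (f := fun _ => 0) w
    (fun R => (hw.aestronglyMeasurable.sub aestronglyMeasurable_const).sup
      aestronglyMeasurable_const) hw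
    (fun R => Eventually.of_forall fun x => by
      rw [Real.norm_of_nonneg (le_max_right _ _)]
      exact max_le (sub_le_self _ (Nat.cast_nonneg _)) (hw0 x))
    (Eventually.of_forall fun x => by
      refine tendsto_const_nhds.congr' ?_
      filter_upwards [eventually_ge_atTop ⌈w x⌉₊] with R hR
      exact (max_eq_right (sub_nonpos.2 (Nat.ceil_le.1 hR))).symm)
  simpa using this

theorem sum_setIntegral_cell_le {S κ : Type*} [MeasurableSpace S] [MeasurableSpace κ]
    [MeasurableSingletonClass κ] {P : Measure S} {w : S → ℝ} (hw : Integrable w P)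
    (hw0 : ∀ x, 0 ≤ w x) {I : S → κ} (hI : Measurable I) (K : Finset κ) :
    ∑ k ∈ K, ∫ x in I ⁻¹' {k}, w x ∂P ≤ ∫ x, w x ∂P := by
  rw [← integral_biUnion_finset K (fun k _ => hI (measurableSet_singleton k)) ?_
    (fun k _ => hw.integrableOn)]
  · exact setIntegral_le_integral hw (Eventually.of_forall hw0)
  · intro k _ k' _ hkk'
    exact Disjoint.preimage _ (by simpa using hkk')

/-- Since `w` may be unbounded, use `w ≤ R + (w - R)⁺`. The constant `R` contributes at most `R G h
^ d` per cell, which beats the telescoped oscillation as the mesh shrinks. The excess has small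
total integral and is multiplied by oscillations at most `B`. Neither bound depends on `f`, so one
`N` serves all. -/
theorem exists_grid_oscillation_le {d : ℕ} {a : Fin d → ℝ} {P : Measure (Set.Ici a)}
    [IsFiniteMeasure P] {G : ℝ} (hG : 0 ≤ G) (hP : P ≤ ENNReal.ofReal G • lebesgueOn (Set.Ici a))
    {w : Set.Ici a → ℝ} (hw : Integrable w P) (hw0 : ∀ x, 0 ≤ w x) {B : ℝ} (hB : 0 ≤ B)
    {ρ : ℕ} (hρ : 0 < ρ) {ε : ℝ} (hε : 0 < ε) :
    ∃ N : ℕ, 0 < N ∧ ∀ f : Set.Ici a → ℝ, Antitone f → (∀ x, 0 ≤ f x) → (∀ x, f x ≤ B) →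
      ∑ k ∈ Fintype.piFinset fun _ : Fin d => Finset.range N,
        (f (gridPoint a (ρ / N) k) - f (gridPoint a (ρ / N) (k + 1))) *
          ∫ x in cellIndex a ((ρ / N : NNReal) : ℝ) ⁻¹' {k}, w x ∂P ≤ ε := by
  have hε2 : 0 < ε / (2 * (B + 1)) := by positivity
  obtain ⟨R, hR⟩ := ((tendsto_integral_posPart_sub_nat hw hw0).eventually_lt_const hε2).exists
  have hlim : Tendsto (fun N : ℕ => (R * G * B * (ρ : ℝ) ^ d) *
      (((N : ℝ) ^ d - ((N - 1 : ℕ) : ℝ) ^ d) / (N : ℝ) ^ d)) atTop (𝓝 0) := by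
    simpa using (tendsto_pow_sub_pow_div_pow d).const_mul (R * G * B * (ρ : ℝ) ^ d)
  obtain ⟨N, hNε, hN⟩ :=
    ((hlim.eventually_lt_const (half_pos hε)).and (eventually_gt_atTop 0)).exists
  refine ⟨N, hN, fun f hf hf0 hfB => ?_⟩
  have hN0 : (0 : ℝ) < N := Nat.cast_pos.2 hN
  set h : NNReal := ρ / N with hh
  have hh0 : 0 < h := div_pos (Nat.cast_pos.2 hρ) (Nat.cast_pos.2 hN)
  set K := Fintype.piFinset fun _ : Fin d => Finset.range N
  let v : Set.Ici a → ℝ := fun x => max (w x - R) 0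
  have hv0 : ∀ x, 0 ≤ v x := fun x => le_max_right _ _
  have hv : Integrable v P := (hw.sub (integrable_const _)).sup (integrable_const _)
  have hI := measurable_cellIndex a (h : ℝ)
  have hosc0 : ∀ k : Fin d → ℕ, 0 ≤ f (gridPoint a h k) - f (gridPoint a h (k + 1)) := fun k =>
    sub_nonneg.2 (hf fun i => by
      change a i + (k i : ℝ) * h ≤ a i + ((k i + 1 : ℕ) : ℝ) * h
      push_cast
      nlinarith [h.coe_nonneg])
  have hoscB : ∀ k : Fin d → ℕ, f (gridPoint a h k) - f (gridPoint a h (k + 1)) ≤ B := fun k => by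
    linarith [hf0 (gridPoint a h (k + 1)), hfB (gridPoint a h k)]
  have hcell : ∀ k, P.real (cellIndex a (h : ℝ) ⁻¹' {k}) ≤ G * (h : ℝ) ^ d := fun k => by
    refine ENNReal.toReal_le_of_le_ofReal (by positivity) ?_
    rw [ENNReal.ofReal_mul hG]
    exact (hP _).trans (mul_le_mul_right (lebesgueOn_cell_le hh0 k) _)
  have hint : ∀ k, ∫ x in cellIndex a (h : ℝ) ⁻¹' {k}, w x ∂P ≤
      R * (G * (h : ℝ) ^ d) + ∫ x in cellIndex a (h : ℝ) ⁻¹' {k}, v x ∂P := fun k => by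
    have h1 : ∫ x in cellIndex a (h : ℝ) ⁻¹' {k}, w x ∂P ≤
        ∫ x in cellIndex a (h : ℝ) ⁻¹' {k}, ((R : ℝ) + v x) ∂P :=
      integral_mono hw.integrableOn ((integrable_const _).add hv).integrableOn fun x => by
        have := le_max_left (w x - R) 0
        simp only [v]
        linarith
    rw [integral_add (integrable_const _) hv.integrableOn, setIntegral_const, smul_eq_mul] at h1
    have := mul_le_mul_of_nonneg_right (hcell k) (Nat.cast_nonneg (α := ℝ) R)
    linarith
  have hsum := sum_diagonal_oscillation_le (N := N) (fun k => f (gridPoint a h k))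
    (fun k => hf0 _) (fun k => hfB _)
  calc ∑ k ∈ K, (f (gridPoint a h k) - f (gridPoint a h (k + 1))) *
          ∫ x in cellIndex a (h : ℝ) ⁻¹' {k}, w x ∂P
      ≤ ∑ k ∈ K, ((f (gridPoint a h k) - f (gridPoint a h (k + 1))) * (R * (G * (h : ℝ) ^ d)) +
          B * ∫ x in cellIndex a (h : ℝ) ⁻¹' {k}, v x ∂P) := by
        refine Finset.sum_le_sum fun k _ => ?_
        have h1 := mul_le_mul_of_nonneg_left (hint k) (hosc0 k)
        have h2 := mul_le_mul_of_nonneg_right (hoscB k)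
          (integral_nonneg (μ := P.restrict (cellIndex a (h : ℝ) ⁻¹' {k})) hv0)
        linarith
    _ = (∑ k ∈ K, (f (gridPoint a h k) - f (gridPoint a h (k + 1)))) * (R * (G * (h : ℝ) ^ d)) +
          B * ∑ k ∈ K, ∫ x in cellIndex a (h : ℝ) ⁻¹' {k}, v x ∂P := by
        rw [Finset.sum_add_distrib, Finset.sum_mul, Finset.mul_sum]
    _ ≤ (B * ((N : ℝ) ^ d - ((N - 1 : ℕ) : ℝ) ^ d)) * (R * (G * (h : ℝ) ^ d)) +
          B * ∫ x, v x ∂P := by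
        gcongr
        exact sum_setIntegral_cell_le hv hv0 hI K
    _ ≤ ε / 2 + ε / 2 := by
        refine add_le_add (le_trans (le_of_eq ?_) hNε.le) ?_
        · rw [hh]
          push_cast
          rw [div_pow]
          ring
        · have h1 : B * ∫ x, v x ∂P ≤ B * (ε / (2 * (B + 1))) :=
            mul_le_mul_of_nonneg_left hR.le hB
          refine h1.trans ?_
          rw [mul_div_assoc', div_le_div_iff₀ (by positivity) (by positivity)]
          nlinarith
    _ = ε := add_halves ε

theorem measurableSet_box {d : ℕ} (a : Fin d → ℝ) (ρ : ℝ) :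
    MeasurableSet {x : Set.Ici a | ∀ i, x.1 i - a i < ρ} := by
  rw [Set.ofPred_forall]
  refine MeasurableSet.iInter fun i => measurableSet_lt ?_ measurable_const
  exact ((measurable_pi_apply i).comp measurable_subtype_coe).sub_const _

theorem exists_box_integral_compl_le {d : ℕ} {a : Fin d → ℝ} {P : Measure (Set.Ici a)}
    {φ : Set.Ici a → ℝ} (hφ : Integrable φ P) {C ε : ℝ} (hε : 0 < ε) :
    ∃ ρ : ℕ, 0 < ρ ∧ C * ∫ x, {x : Set.Ici a | ∀ i, x.1 i - a i < ρ}ᶜ.indicator φ x ∂P ≤ ε := by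
  have := tendsto_integral_of_dominated_convergence (μ := P)
    (F := fun (ρ : ℕ) => {x : Set.Ici a | ∀ i, x.1 i - a i < ρ}ᶜ.indicator φ) (f := fun _ => 0)
    (fun x => ‖φ x‖)
    (fun ρ => hφ.aestronglyMeasurable.indicator (measurableSet_box a ρ).compl) hφ.norm
    (fun ρ => Eventually.of_forall fun x => norm_indicator_le_norm_self _ _)
    (Eventually.of_forall fun x => by
      refine tendsto_const_nhds.congr' ?_
      have : ∀ i, ∀ᶠ ρ : ℕ in atTop, x.1 i - a i < ρ := fun i =>
        tendsto_natCast_atTop_atTop.eventually_gt_atTop _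
      filter_upwards [eventually_all.2 this] with ρ hρ
      have hx : x ∉ {x : Set.Ici a | ∀ i, x.1 i - a i < ρ}ᶜ := Set.notMem_compl_iff.2 hρ
      exact (Set.indicator_of_notMem hx _).symm)
  simp only [integral_zero] at this
  have h2 := this.const_mul C
  rw [mul_zero] at h2
  obtain ⟨ρ, h1, h3⟩ := ((h2.eventually_lt_const hε).and (eventually_gt_atTop 0)).exists
  exact ⟨ρ, h3, h1.le⟩

/-- Bracketing: the test functions are `φ / g₀` on each cell of a box and `φ` off the box. Every `φ
L` lies between two combinations of them with bounded coefficients, namely corner values of `f = L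
g₀` on the cells, and `0` or `C` off the box. -/
theorem exists_finset_uniform_of_nonneg {d : ℕ} {a : Fin d → ℝ} {g₀ : Set.Ici a → ℝ}
    (hpos : ∀ x, 0 < g₀ x) (hg : Antitone g₀) {P : Measure (Set.Ici a)} [IsFiniteMeasure P]
    (hP : P ≤ ENNReal.ofReal (g₀ ⟨a, Set.self_mem_Ici⟩) • lebesgueOn (Set.Ici a))
    {φ : Set.Ici a → ℝ} (hφ : Integrable φ P) (hφ0 : ∀ x, 0 ≤ φ x) {B C : ℝ} (hB : 0 ≤ B)
    (hC : 0 ≤ C) {ε : ℝ} (hε : 0 < ε) :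
    ∃ T : Finset (Set.Ici a → ℝ), ∃ η : ℝ, 0 < η ∧ (∀ ψ ∈ T, Integrable ψ P) ∧
      ∀ (n : ℕ) (x : Fin n → Set.Ici a), (∀ ψ ∈ T, |sampleMean x ψ - expect P ψ| ≤ η) →
        ∀ L : Set.Ici a → ℝ, AEMeasurable L P → (∀ s, 0 ≤ L s) → (∀ s, L s ≤ C) →
          Antitone (fun s => L s * g₀ s) → (∀ s, L s * g₀ s ≤ B) →
          |sampleMean x (fun s => φ s * L s) - expect P fun s => φ s * L s| ≤ ε := by
  classical
  obtain ⟨ρ, hρ, hout⟩ := exists_box_integral_compl_le (C := C) hφ (show 0 < ε / 4 by positivity)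
  set box : Set (Set.Ici a) := {x | ∀ i, x.1 i - a i < ρ}
  let w : Set.Ici a → ℝ := box.indicator fun s => φ s / g₀ s
  have hboxm : MeasurableSet box := measurableSet_box a ρ
  have hPac : P ≪ lebesgueOn (Set.Ici a) :=
    (Measure.absolutelyContinuous_of_le hP).trans Measure.smul_absolutelyContinuous
  have hgm : AEMeasurable g₀ P := (aemeasurable_of_antitone hg).mono_ac hPac
  have hw0 : ∀ s, 0 ≤ w s := fun s =>
    Set.indicator_nonneg (fun s _ => div_nonneg (hφ0 s) (hpos s).le) s
  have hw : Integrable w P := by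
    -- The far corner of the box, where the antitone `g₀` gives a positive lower bound for its
    -- values on the box.
    let b : Set.Ici a := gridPoint a ρ 1
    refine (hφ.div_const (g₀ b)).mono
      ((hφ.aestronglyMeasurable.aemeasurable.div hgm).aestronglyMeasurable.indicator hboxm)
      (Eventually.of_forall fun s => ?_)
    rw [Real.norm_of_nonneg (hw0 s), Real.norm_of_nonneg (div_nonneg (hφ0 s) (hpos b).le)]
    by_cases hs : s ∈ box
    · simp only [w, Set.indicator_of_mem hs]
      refine div_le_div_of_nonneg_left (hφ0 s) (hpos b) (hg fun i => ?_)
      have := hs i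
      change s.1 i ≤ a i + ((1 : ℕ) : ℝ) * ((ρ : NNReal) : ℝ)
      push_cast
      linarith
    · simp only [w, Set.indicator_of_notMem hs]
      exact div_nonneg (hφ0 s) (hpos b).le
  obtain ⟨N, hN, hosc⟩ := exists_grid_oscillation_le (hpos _).le hP hw hw0 hB hρ
    (show 0 < ε / 4 by positivity)
  set h : NNReal := ρ / N with hh
  have hh0 : 0 < h := div_pos (Nat.cast_pos.2 hρ) (Nat.cast_pos.2 hN)
  set K := Fintype.piFinset fun _ : Fin d => Finset.range N with hK
  have hI := measurable_cellIndex a (h : ℝ)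
  have hIm : ∀ k, MeasurableSet (cellIndex a (h : ℝ) ⁻¹' {k}) := fun k =>
    hI (measurableSet_singleton k)
  let ψ : (Fin d → ℕ) → Set.Ici a → ℝ := fun k => (cellIndex a (h : ℝ) ⁻¹' {k}).indicator w
  let ψ' : Set.Ici a → ℝ := boxᶜ.indicator φ
  have hψ : ∀ k, Integrable (ψ k) P := fun k => hw.indicator (hIm k)
  have hψ' : Integrable ψ' P := hφ.indicator hboxm.compl
  have hψ0 : ∀ k s, 0 ≤ ψ k s := fun k s => Set.indicator_nonneg (fun s _ => hw0 s) s
  have hψ'0 : ∀ s, 0 ≤ ψ' s := fun s => Set.indicator_nonneg (fun s _ => hφ0 s) s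
  -- Chosen so that the sampling error of either bracket is at most `ε / 4`; the `+ 1` keeps the
  -- denominator positive.
  set η : ℝ := ε / (4 * (B * K.card + C + 1)) with hη
  have hη0 : 0 < η := by positivity
  refine ⟨insert ψ' (K.image ψ), η, hη0, ?_, ?_⟩
  · intro θ hθ
    rcases Finset.mem_insert.1 hθ with rfl | hθ
    · exact hψ'
    · obtain ⟨k, -, rfl⟩ := Finset.mem_image.1 hθ
      exact hψ k
  intro n x hx L hLm hL0 hLC hf hfB
  have hxψ : ∀ k ∈ K, |sampleMean x (ψ k) - expect P (ψ k)| ≤ η := fun k hk =>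
    hx _ (Finset.mem_insert_of_mem (Finset.mem_image_of_mem _ hk))
  have hxψ' : |sampleMean x ψ' - expect P ψ'| ≤ η := hx _ (Finset.mem_insert_self _ _)
  set f : Set.Ici a → ℝ := fun s => L s * g₀ s with hfdef
  have hf0 : ∀ s, 0 ≤ f s := fun s => mul_nonneg (hL0 s) (hpos s).le
  have hosc := hosc f hf hf0 hfB
  -- A point lies in one cell only, and `w` vanishes off the box, so cells with index outside `K` do
  -- no harm.
  have hsum : ∀ (c : (Fin d → ℕ) → ℝ) (s : Set.Ici a),
      ∑ k ∈ K, c k * ψ k s = c (cellIndex a h s) * w s := by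
    intro c s
    by_cases hs : cellIndex a h s ∈ K
    · rw [Finset.sum_eq_single_of_mem _ hs]
      · simp [ψ]
      · intro k _ hk
        have : s ∉ cellIndex a (h : ℝ) ⁻¹' {k} := fun h => hk h.symm
        simp [ψ, Set.indicator_of_notMem this]
    · have hsb : s ∉ box := fun hsb => hs (Fintype.mem_piFinset.2 fun i =>
        Finset.mem_range.2 ((lt_of_mem_box hN hρ s i).2 (hsb i)))
      have : w s = 0 := Set.indicator_of_notMem hsb _
      rw [this, mul_zero]
      refine Finset.sum_eq_zero fun k _ => ?_
      simp [ψ, Set.indicator_apply, this]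
  let U : Set.Ici a → ℝ := fun s => ∑ k ∈ K, f (gridPoint a h k) * ψ k s + C * ψ' s
  let l : Set.Ici a → ℝ := fun s => ∑ k ∈ K, f (gridPoint a h (k + 1)) * ψ k s
  have hφL : ∀ s ∈ box, φ s * L s = w s * f s := fun s hs => by
    simp only [w, Set.indicator_of_mem hs, hfdef]
    have := (hpos s).ne'
    field_simp
  have hU : ∀ s, φ s * L s ≤ U s := by
    intro s
    simp only [U, hsum]
    by_cases hs : s ∈ box
    · rw [hφL s hs, mul_comm]
      have := mul_le_mul_of_nonneg_right (hf (gridPoint_cellIndex_le hh0 s)) (hw0 s)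
      have := mul_nonneg hC (hψ'0 s)
      linarith
    · have h1 : w s = 0 := Set.indicator_of_notMem hs _
      have h2 : ψ' s = φ s := Set.indicator_of_mem (Set.mem_compl hs) _
      rw [h1, h2, mul_zero, zero_add, mul_comm]
      exact mul_le_mul_of_nonneg_right (hLC s) (hφ0 s)
  have hl : ∀ s, l s ≤ φ s * L s := by
    intro s
    simp only [l, hsum]
    by_cases hs : s ∈ box
    · rw [hφL s hs, mul_comm]
      exact mul_le_mul_of_nonneg_left (hf (le_gridPoint_cellIndex hh0 s)) (hw0 s)
    · have h1 : w s = 0 := Set.indicator_of_notMem hs _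
      rw [h1, mul_zero]
      exact mul_nonneg (hφ0 s) (hL0 s)
  have hli : Integrable l P := integrable_finsetSum _ fun k _ => (hψ k).const_mul _
  have hUi : Integrable U P :=
    (integrable_finsetSum _ fun k _ => (hψ k).const_mul _).add (hψ'.const_mul _)
  have hφLi : Integrable (fun s => φ s * L s) P := by
    refine hφ.mul_bdd (c := C) hLm.aestronglyMeasurable (Eventually.of_forall fun s => ?_)
    rw [Real.norm_of_nonneg (hL0 s)]
    exact hLC s
  have hEU : expect P U = ∑ k ∈ K, f (gridPoint a h k) * expect P (ψ k) + C * expect P ψ' := by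
    simp only [expect, U]
    rw [integral_add (integrable_finsetSum _ fun k _ => (hψ k).const_mul _) (hψ'.const_mul _),
      integral_finsetSum _ fun k _ => (hψ k).const_mul _]
    simp only [integral_const_mul]
  have hEl : expect P l = ∑ k ∈ K, f (gridPoint a h (k + 1)) * expect P (ψ k) := by
    simp only [expect, l]
    rw [integral_finsetSum _ fun k _ => (hψ k).const_mul _]
    simp only [integral_const_mul]
  have hSU : sampleMean x U =
      ∑ k ∈ K, f (gridPoint a h k) * sampleMean x (ψ k) + C * sampleMean x ψ' := by
    simp only [U]
    rw [sampleMean_add, sampleMean_sum, sampleMean_const_mul]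
    simp only [sampleMean_const_mul]
  have hSl : sampleMean x l = ∑ k ∈ K, f (gridPoint a h (k + 1)) * sampleMean x (ψ k) := by
    simp only [l]
    rw [sampleMean_sum]
    simp only [sampleMean_const_mul]
  have hdiff : ∀ c : (Fin d → ℕ) → ℝ, (∀ k, 0 ≤ c k ∧ c k ≤ B) →
      |∑ k ∈ K, c k * sampleMean x (ψ k) - ∑ k ∈ K, c k * expect P (ψ k)| ≤ B * K.card * η := by
    intro c hc
    rw [← Finset.sum_sub_distrib]
    refine (Finset.abs_sum_le_sum_abs _ _).trans ?_
    have : ∀ k ∈ K, |c k * sampleMean x (ψ k) - c k * expect P (ψ k)| ≤ B * η := fun k hk => by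
      rw [← mul_sub, abs_mul, abs_of_nonneg (hc k).1]
      exact mul_le_mul (hc k).2 (hxψ k hk) (abs_nonneg _) hB
    refine (Finset.sum_le_card_nsmul _ _ _ this).trans (le_of_eq ?_)
    rw [nsmul_eq_mul]
    ring
  -- One quarter comes from the oscillation on the cells, the other from the exterior of the box.
  have hosc' : expect P U - expect P l ≤ ε / 4 + ε / 4 := by
    rw [hEU, hEl]
    have h1 : ∀ k, expect P (ψ k) = ∫ s in cellIndex a (h : ℝ) ⁻¹' {k}, w s ∂P := fun k =>
      integral_indicator (hIm k)
    simp only [sub_mul, Finset.sum_sub_distrib] at hosc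
    simp only [h1]
    have h2 : C * expect P ψ' ≤ ε / 4 := hout
    linarith
  have hηε : (B * K.card + C) * η ≤ ε / 4 := by
    rw [hη, mul_div_assoc', div_le_div_iff₀ (by positivity) (by positivity)]
    nlinarith
  have e1 := hdiff (fun k => f (gridPoint a h k)) fun k => ⟨hf0 _, hfB _⟩
  have e2 := hdiff (fun k => f (gridPoint a h (k + 1))) fun k => ⟨hf0 _, hfB _⟩
  have m1 := sampleMean_mono x hU
  have m2 := sampleMean_mono x hl
  have m3 : expect P (fun s => φ s * L s) ≤ expect P U := integral_mono hφLi hUi hU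
  have m4 : expect P l ≤ expect P (fun s => φ s * L s) := integral_mono hli hφLi hl
  have e3 : C * |sampleMean x ψ' - expect P ψ'| ≤ C * η := mul_le_mul_of_nonneg_left hxψ' hC
  rw [← abs_of_nonneg hC, ← abs_mul, abs_of_nonneg hC, mul_sub] at e3
  rw [abs_le] at e1 e2 e3 ⊢
  constructor <;> nlinarith

theorem exists_finset_uniform {d : ℕ} {a : Fin d → ℝ} {g₀ : Set.Ici a → ℝ}
    (hpos : ∀ x, 0 < g₀ x) (hg : Antitone g₀) {P : Measure (Set.Ici a)} [IsFiniteMeasure P]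
    (hP : P ≤ ENNReal.ofReal (g₀ ⟨a, Set.self_mem_Ici⟩) • lebesgueOn (Set.Ici a))
    {φ : Set.Ici a → ℝ} (hφ : Integrable φ P) {B C : ℝ} (hB : 0 ≤ B)
    (hC : 0 ≤ C) {ε : ℝ} (hε : 0 < ε) :
    ∃ T : Finset (Set.Ici a → ℝ), ∃ η : ℝ, 0 < η ∧ (∀ ψ ∈ T, Integrable ψ P) ∧
      ∀ (n : ℕ) (x : Fin n → Set.Ici a), (∀ ψ ∈ T, |sampleMean x ψ - expect P ψ| ≤ η) →
        ∀ L : Set.Ici a → ℝ, AEMeasurable L P → (∀ s, 0 ≤ L s) → (∀ s, L s ≤ C) →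
          Antitone (fun s => L s * g₀ s) → (∀ s, L s * g₀ s ≤ B) →
          |sampleMean x (fun s => φ s * L s) - expect P fun s => φ s * L s| ≤ ε := by
  classical
  obtain ⟨T₁, η₁, hη₁, hT₁, h₁⟩ := exists_finset_uniform_of_nonneg hpos hg hP hφ.pos_part
    (fun s => le_max_right _ _) hB hC (half_pos hε)
  obtain ⟨T₂, η₂, hη₂, hT₂, h₂⟩ := exists_finset_uniform_of_nonneg hpos hg hP hφ.neg_part
    (fun s => le_max_right _ _) hB hC (half_pos hε)
  refine ⟨T₁ ∪ T₂, min η₁ η₂, lt_min hη₁ hη₂, fun ψ hψ => ?_, ?_⟩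
  · rcases Finset.mem_union.1 hψ with h | h
    · exact hT₁ ψ h
    · exact hT₂ ψ h
  intro n x hx L hLm hL0 hLC hf hfB
  have k₁ := h₁ n x (fun ψ hψ => (hx ψ (Finset.mem_union_left _ hψ)).trans (min_le_left _ _))
    L hLm hL0 hLC hf hfB
  have k₂ := h₂ n x (fun ψ hψ => (hx ψ (Finset.mem_union_right _ hψ)).trans (min_le_right _ _))
    L hLm hL0 hLC hf hfB
  have hbdd : ∀ᵐ s ∂P, ‖L s‖ ≤ C := Eventually.of_forall fun s => by
    rw [Real.norm_of_nonneg (hL0 s)]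
    exact hLC s
  have heq : (fun s => φ s * L s) =
      fun s => max (φ s) 0 * L s - max (-φ s) 0 * L s := funext fun s => by
    rw [← sub_mul]
    congr 1
    exact (max_zero_sub_eq_self (φ s)).symm
  rw [heq, sampleMean_sub]
  have : expect P (fun s => max (φ s) 0 * L s - max (-φ s) 0 * L s) =
      expect P (fun s => max (φ s) 0 * L s) - expect P fun s => max (-φ s) 0 * L s :=
    integral_sub (hφ.pos_part.mul_bdd hLm.aestronglyMeasurable hbdd)
      (hφ.neg_part.mul_bdd hLm.aestronglyMeasurable hbdd)
  rw [this]
  rw [abs_le] at *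
  constructor <;> linarith

/-! ### Convex sets in finite dimension -/

/-- In finite dimension, a convex set has all the interior of its closure. -/
theorem _root_.Convex.interior_closure_subset {V : Type*} [NormedAddCommGroup V]
    [NormedSpace ℝ V] [FiniteDimensional ℝ V] {A : Set V} (hA : Convex ℝ A) :
    interior (closure A) ⊆ A := by
  intro x hx
  -- Affine subspaces are closed here, so `A` and its closure have the same span, and `A` has an
  -- interior point `y`. Pushing `x` slightly away from `y` stays in the closure and puts `x` inside
  -- an open segment ending at `y`.
  have hspan : affineSpan ℝ A = ⊤ := by
    have h1 : affineSpan ℝ (closure A) = ⊤ :=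
      (hA.closure.interior_nonempty_iff_affineSpan_eq_top).1 ⟨x, hx⟩
    have hcl : IsClosed (affineSpan ℝ A : Set V) := AffineSubspace.closed_of_finiteDimensional _
    have h2 : affineSpan ℝ (closure A) ≤ affineSpan ℝ A :=
      affineSpan_le.2 (hcl.closure_subset_iff.2 (subset_affineSpan ℝ A))
    exact top_le_iff.1 (h1 ▸ h2)
  obtain ⟨y, hy⟩ := (hA.interior_nonempty_iff_affineSpan_eq_top).2 hspan
  have hcont : ContinuousAt (fun t : ℝ => x + t • (x - y)) 0 := by fun_prop
  have hev : ∀ᶠ t in 𝓝 (0 : ℝ), x + t • (x - y) ∈ closure A := by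
    have := hcont.preimage_mem_nhds (t := closure A)
      (by simpa using mem_interior_iff_mem_nhds.1 hx)
    exact this
  obtain ⟨t, ht, ht0⟩ := ((hev.filter_mono nhdsWithin_le_nhds).and
    (eventually_mem_nhdsWithin (s := Set.Ioi (0 : ℝ)))).exists
  have ht0 : 0 < t := ht0
  refine interior_subset (hA.openSegment_interior_closure_subset_interior hy ht
    ⟨t / (1 + t), 1 / (1 + t), by positivity, by positivity, by field_simp; ring, ?_⟩)
  have h1 : (1 + t) ≠ 0 := by positivity
  rw [smul_add, smul_smul, smul_sub]
  have e1 : (1 : ℝ) / (1 + t) * t = t / (1 + t) := by ring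
  rw [e1]
  have e2 : (1 : ℝ) / (1 + t) = 1 - t / (1 + t) := by field_simp; ring
  rw [e2, sub_smul, one_smul]
  abel

/-- A convex set that comes within `η` of every point of a ball of radius `r` contains the
concentric ball of radius `r - η`. -/
theorem _root_.Convex.ball_subset_of_forall_exists_dist_le {V : Type*} [NormedAddCommGroup V]
    [NormedSpace ℝ V] [FiniteDimensional ℝ V] {A : Set V} (hA : Convex ℝ A) {c : V} {r η : ℝ}
    (hη : 0 ≤ η) (h : ∀ v ∈ Metric.ball c r, ∃ y ∈ A, dist y v ≤ η) :
    Metric.ball c (r - η) ⊆ A := by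
  have hcl : Metric.ball c (r - η) ⊆ closure A := by
    intro u hu
    by_contra hu'
    -- Separate `u` from the closure by `ℓ`, then move from `u` by less than `η'` in a direction
    -- nearly attaining `‖ℓ‖`. As `η < η'`, this reaches a point of the ball where `ℓ` is too large
    -- for any point of `A` within `η`.
    obtain ⟨ℓ, q, hℓ, hq⟩ := geometric_hahn_banach_closed_point hA.closure isClosed_closure hu'
    rw [Metric.mem_ball] at hu
    set η' := r - dist u c with hη'
    have hηη' : η < η' := by linarith
    have hη'0 : 0 < η' := hη.trans_lt hηη'
    have hℓ0 : ℓ ≠ 0 := by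
      rintro rfl
      obtain ⟨y, hy, -⟩ := h u (by rw [Metric.mem_ball]; linarith)
      have := hℓ y (subset_closure hy)
      simp only [zero_apply] at this hq
      linarith
    have hnorm : 0 < ‖ℓ‖ := norm_pos_iff.2 hℓ0
    obtain ⟨e, he1, he2⟩ := ℓ.exists_lt_apply_of_lt_opNorm (r := ‖ℓ‖ * (η / η'))
      (mul_lt_of_lt_one_right hnorm ((div_lt_one hη'0).2 hηη'))
    obtain ⟨e, he1, he2⟩ : ∃ e : V, ‖e‖ < 1 ∧ ‖ℓ‖ * (η / η') < ℓ e := by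
      rcases le_total 0 (ℓ e) with h0 | h0
      · exact ⟨e, he1, by rwa [Real.norm_of_nonneg h0] at he2⟩
      · exact ⟨-e, by rwa [norm_neg], by rwa [map_neg, ← Real.norm_of_nonpos h0]⟩
    obtain ⟨y, hy, hyv⟩ := h (u + η' • e) (by
      rw [Metric.mem_ball]
      calc dist (u + η' • e) c ≤ dist (u + η' • e) u + dist u c := dist_triangle _ _ _
        _ = η' * ‖e‖ + dist u c := by
          rw [dist_eq_norm, add_sub_cancel_left, norm_smul, Real.norm_of_nonneg hη'0.le]
        _ < r := by nlinarith)
    have h1 := hℓ y (subset_closure hy)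
    have h2 : ℓ (u + η' • e) - ℓ y ≤ ‖ℓ‖ * η := by
      rw [← map_sub]
      refine (le_abs_self _).trans ((ℓ.le_opNorm _).trans ?_)
      rw [← dist_eq_norm, dist_comm]
      exact mul_le_mul_of_nonneg_left hyv hnorm.le
    rw [map_add, map_smul, smul_eq_mul] at h2
    have h3 : ‖ℓ‖ * η < η' * ℓ e := by
      have := mul_lt_mul_of_pos_left he2 hη'0
      have e : η' * (‖ℓ‖ * (η / η')) = ‖ℓ‖ * η := by field_simp
      linarith
    linarith
  exact fun u hu => hA.interior_closure_subset
    (interior_maximal hcl Metric.isOpen_ball hu)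

/-! ### Stability of the optimal value under the Slater condition -/

/-- `L ↦ E[φ L]` respects convex combinations of elements of `𝓛`. -/
def MomentAffineOn {S : Type*} (E : (S → ℝ) → ℝ) (φ : S → ℝ) (𝓛 : Set (S → ℝ)) : Prop :=
  ∀ L ∈ 𝓛, ∀ L' ∈ 𝓛, ∀ s t : ℝ, 0 ≤ s → 0 ≤ t → s + t = 1 →
    E (fun x => φ x * (s • L + t • L') x) =
      s * E (fun x => φ x * L x) + t * E (fun x => φ x * L' x)

/-- The objective and constraint functions of a moment problem. -/
def MomentData.functions {S : Type*} {m p : ℕ} (D : MomentData S m p) : Set (S → ℝ) :=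
  insert D.φ₀ (Set.range D.φI ∪ Set.range D.φE)

namespace MomentData

variable {S : Type*} {m p : ℕ} (D : MomentData S m p)

theorem φ₀_mem : D.φ₀ ∈ D.functions := Set.mem_insert _ _

theorem φI_mem (j : Fin m) : D.φI j ∈ D.functions := Or.inr (Or.inl ⟨j, rfl⟩)

theorem φE_mem (j : Fin p) : D.φE j ∈ D.functions := Or.inr (Or.inr ⟨j, rfl⟩)

/-- A point feasible for the moment operator `E` can be repaired, at a small loss in the objective,
into one feasible for a nearby operator `E'` satisfying a quantitative Slater condition. -/
theorem exists_feasible_transfer {𝓛 : Set (S → ℝ)} (h𝓛 : Convex ℝ 𝓛) {K σ r ε : ℝ} (hK : 0 < K)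
    (hσ : 0 < σ) (hr : 0 < r) (hε : 0 < ε) (hμ : ∀ j, |D.μI j| ≤ K) :
    ∃ η : ℝ, 0 < η ∧ ∀ E E' : (S → ℝ) → ℝ,
      (∀ φ ∈ D.functions, MomentAffineOn E' φ 𝓛) →
      (∀ φ ∈ D.functions, ∀ L ∈ 𝓛, |E (fun x => φ x * L x) - E' fun x => φ x * L x| ≤ η) →
      (∀ φ ∈ D.functions, ∀ L ∈ 𝓛, |E' fun x => φ x * L x| ≤ K) →
      ∀ L₀ ∈ 𝓛, (∀ j, E' (fun x => D.φI j x * L₀ x) ≤ D.μI j - σ) →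
      (∀ j, |E' (fun x => D.φE j x * L₀ x) - D.μE j| ≤ η) →
      (∀ v ∈ Metric.closedBall D.μE r, ∃ L ∈ 𝓛, ∀ j, v j = E' fun x => D.φE j x * L x) →
      ∀ L ∈ D.feasible E 𝓛, ∃ L' ∈ D.feasible E' 𝓛, D.objective E L ≤ D.objective E' L' + ε := by
  -- `s` is the weight of the Slater point and `t` that of the equality correction. They cost at
  -- most `2 K s` and `2 K t` in the objective, each within `ε / 4`; the change of operator costs `η
  -- ≤ ε / 2`.
  obtain ⟨s, hs0, hs1, hsε⟩ : ∃ s : ℝ, 0 < s ∧ s ≤ 1 ∧ 8 * K * s ≤ ε := by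
    refine ⟨min 1 (ε / (8 * K)), by positivity, min_le_left _ _, ?_⟩
    rw [mul_comm, ← le_div_iff₀ (by positivity)]
    exact min_le_right _ _
  obtain ⟨t, ht0, ht1, htσ, htε⟩ : ∃ t : ℝ, 0 < t ∧ t ≤ 1 / 2 ∧ 8 * K * t ≤ s * σ ∧
      8 * K * t ≤ ε := by
    refine ⟨min (1 / 2) (min (s * σ / (8 * K)) (ε / (8 * K))), by positivity, min_le_left _ _,
      ?_, ?_⟩
    · rw [mul_comm, ← le_div_iff₀ (by positivity)]
      exact (min_le_right _ _).trans (min_le_left _ _)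
    · rw [mul_comm, ← le_div_iff₀ (by positivity)]
      exact (min_le_right _ _).trans (min_le_right _ _)
  obtain ⟨η, hη0, hηε, hησ, hηr⟩ : ∃ η : ℝ, 0 < η ∧ η ≤ ε / 2 ∧ η ≤ s * σ / 2 ∧ η ≤ t * r :=
    ⟨min (ε / 2) (min (s * σ / 2) (t * r)), by positivity, min_le_left _ _,
      (min_le_right _ _).trans (min_le_left _ _), (min_le_right _ _).trans (min_le_right _ _)⟩
  refine ⟨η, hη0, fun E E' haff hclose hbdd L₀ hL₀ hI₀ hE₀ hball L hL => ?_⟩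
  obtain ⟨hL𝓛, hLI, hLE⟩ := hL
  have hs1' : 0 ≤ 1 - s := by linarith
  have ht1' : 0 ≤ 1 - t := by linarith
  -- This mixture has slack `s σ / 2` in the inequalities, enough to pay for the correction of
  -- weight `t`, and equality defects still at most `η`.
  set L₂ : S → ℝ := (1 - s) • L + s • L₀ with hL₂
  have hL₂𝓛 : L₂ ∈ 𝓛 := h𝓛 hL𝓛 hL₀ hs1' hs0.le (by ring)
  have e₂ : ∀ φ ∈ D.functions, E' (fun x => φ x * L₂ x) =
      (1 - s) * E' (fun x => φ x * L x) + s * E' (fun x => φ x * L₀ x) := fun φ hφ =>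
    haff φ hφ L hL𝓛 L₀ hL₀ _ _ hs1' hs0.le (by ring)
  have hdef : ∀ j, |E' (fun x => D.φE j x * L₂ x) - D.μE j| ≤ η := fun j => by
    have h1 := hclose _ (D.φE_mem j) L hL𝓛
    have h2 := hE₀ j
    rw [hLE j] at h1
    rw [e₂ _ (D.φE_mem j)]
    rw [abs_le] at h1 h2 ⊢
    constructor <;> nlinarith
  -- The equality moments of `L₁` miss `μE` by `-(1 - t) / t` times the defect of `L₂`, so weight
  -- `t` on `L₁` cancels it exactly. The target is in the ball because `η ≤ t r`.
  obtain ⟨L₁, hL₁, hL₁E⟩ := hball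
    (fun j => D.μE j - (1 - t) / t * (E' (fun x => D.φE j x * L₂ x) - D.μE j)) (by
      rw [Metric.mem_closedBall, dist_pi_le_iff hr.le]
      intro j
      rw [Real.dist_eq, sub_sub_cancel_left, abs_neg, abs_mul,
        abs_of_nonneg (div_nonneg ht1' ht0.le), div_mul_eq_mul_div, div_le_iff₀ ht0]
      have := hdef j
      nlinarith [abs_nonneg (E' (fun x => D.φE j x * L₂ x) - D.μE j)])
  have e₃ : ∀ φ ∈ D.functions, E' (fun x => φ x * ((1 - t) • L₂ + t • L₁) x) =
      (1 - t) * E' (fun x => φ x * L₂ x) + t * E' (fun x => φ x * L₁ x) := fun φ hφ =>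
    haff φ hφ L₂ hL₂𝓛 L₁ hL₁ _ _ ht1' ht0.le (by ring)
  refine ⟨(1 - t) • L₂ + t • L₁, ⟨h𝓛 hL₂𝓛 hL₁ ht1' ht0.le (by ring), fun j => ?_, fun j => ?_⟩, ?_⟩
  · rw [e₃ _ (D.φI_mem j), e₂ _ (D.φI_mem j)]
    have h1 := (abs_le.1 (hclose _ (D.φI_mem j) L hL𝓛)).1
    have h2 := hI₀ j
    have h3 := (abs_le.1 (hbdd _ (D.φI_mem j) L₁ hL₁)).2
    have h4 := (abs_le.1 (hμ j)).1
    have h5 := hLI j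
    have h6 : (1 - s) * E' (fun x => D.φI j x * L x) + s * E' (fun x => D.φI j x * L₀ x) ≤
        D.μI j - s * σ / 2 := by nlinarith
    have h7 := mul_le_mul_of_nonneg_left h6 ht1'
    have h8 := mul_le_mul_of_nonneg_left h3 ht0.le
    have h9 : t * (s * σ) ≤ 1 / 2 * (s * σ) :=
      mul_le_mul_of_nonneg_right ht1 (mul_pos hs0 hσ).le
    nlinarith
  · rw [e₃ _ (D.φE_mem j), ← hL₁E j]
    field_simp
    ring
  · unfold MomentData.objective
    rw [e₃ _ D.φ₀_mem, e₂ _ D.φ₀_mem]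
    have h1 := (abs_le.1 (hclose _ D.φ₀_mem L hL𝓛)).2
    have h2 := abs_le.1 (hbdd _ D.φ₀_mem L hL𝓛)
    have h3 := abs_le.1 (hbdd _ D.φ₀_mem L₀ hL₀)
    have h4 := abs_le.1 (hbdd _ D.φ₀_mem L₁ hL₁)
    set x := E' fun x => D.φ₀ x * L x
    set x₀ := E' fun x => D.φ₀ x * L₀ x
    set x₁ := E' fun x => D.φ₀ x * L₁ x
    have h5 : x - 2 * K * s ≤ (1 - s) * x + s * x₀ := by nlinarith
    have h6 := mul_le_mul_of_nonneg_left h5 ht1'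
    have h7 : t * (-K) ≤ t * x₁ := mul_le_mul_of_nonneg_left h4.1 ht0.le
    have h8 : t * x ≤ t * K := mul_le_mul_of_nonneg_left h2.2 ht0.le
    have h9 : 0 ≤ t * (K * s) := by positivity
    nlinarith

/-- Feasible points are transferred in both directions. Towards `E'` this requires the Slater
condition to survive the perturbation, which also makes the perturbed problem feasible. -/
theorem exists_val_sub_abs_le {𝓛 : Set (S → ℝ)} (h𝓛 : Convex ℝ 𝓛) {E : (S → ℝ) → ℝ}
    (haff : ∀ φ ∈ D.functions, MomentAffineOn E φ 𝓛)
    (hbdd : ∀ φ ∈ D.functions, ∃ K, ∀ L ∈ 𝓛, |E fun x => φ x * L x| ≤ K)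
    (hSlater : D.Slater E 𝓛) {ε : ℝ} (hε : 0 < ε) :
    ∃ η : ℝ, 0 < η ∧ ∀ E' : (S → ℝ) → ℝ, (∀ φ ∈ D.functions, MomentAffineOn E' φ 𝓛) →
      (∀ φ ∈ D.functions, ∀ L ∈ 𝓛, |E' (fun x => φ x * L x) - E fun x => φ x * L x| ≤ η) →
      (D.val E' 𝓛 - D.val E 𝓛).abs ≤ ENNReal.ofReal ε := by
  obtain ⟨⟨L₀, hL₀, hI₀, hE₀⟩, hint⟩ := hSlater
  have hfin : D.functions.Finite := ((Set.finite_range _).union (Set.finite_range _)).insert _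
  obtain ⟨K, hK0, hK, hμ⟩ : ∃ K : ℝ, 0 < K ∧
      (∀ φ ∈ D.functions, ∀ L ∈ 𝓛, |E fun x => φ x * L x| ≤ K) ∧ ∀ j, |D.μI j| ≤ K := by
    have h1 : ∀ᶠ K : ℝ in atTop, ∀ φ ∈ D.functions, ∀ L ∈ 𝓛, |E fun x => φ x * L x| ≤ K :=
      (eventually_all_finite hfin).2 fun φ hφ => by
        obtain ⟨k, hk⟩ := hbdd φ hφ
        filter_upwards [eventually_ge_atTop k] with K hK L hL using (hk L hL).trans hK
    have h2 : ∀ᶠ K : ℝ in atTop, ∀ j, |D.μI j| ≤ K :=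
      eventually_all.2 fun j => eventually_ge_atTop _
    obtain ⟨K, h⟩ := ((eventually_gt_atTop 0).and (h1.and h2)).exists
    exact ⟨K, h⟩
  obtain ⟨σ, hσ0, hσ⟩ : ∃ σ : ℝ, 0 < σ ∧
      ∀ j, E (fun x => D.φI j x * L₀ x) ≤ D.μI j - σ := by
    have h1 : ∀ᶠ σ in 𝓝[>] (0 : ℝ), ∀ j, E (fun x => D.φI j x * L₀ x) ≤ D.μI j - σ :=
      eventually_all.2 fun j => by
        filter_upwards [Ioo_mem_nhdsGT (sub_pos.2 (hI₀ j))] with σ hσ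
        linarith [hσ.2]
    obtain ⟨σ, h⟩ := (eventually_mem_nhdsWithin.and h1).exists
    exact ⟨σ, h⟩
  obtain ⟨r, hr0, hr⟩ := Metric.mem_nhds_iff.1 (mem_interior_iff_mem_nhds.1 hint)
  -- The constants are weakened so that they hold both for `E` and for every `E'` close enough to
  -- it.
  obtain ⟨η₀, hη₀, H⟩ := D.exists_feasible_transfer h𝓛 (K := K + 1) (σ := σ / 2) (r := r / 2)
    (by positivity) (by positivity) (by positivity) hε (fun j => (hμ j).trans (by linarith))
  obtain ⟨η, hη, hηη₀, hη1, hησ, hηr⟩ : ∃ η : ℝ, 0 < η ∧ η ≤ η₀ ∧ η ≤ 1 ∧ η ≤ σ / 2 ∧ η ≤ r / 4 :=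
    ⟨min (min η₀ 1) (min (σ / 2) (r / 4)), by positivity,
      (min_le_left _ _).trans (min_le_left _ _), (min_le_left _ _).trans (min_le_right _ _),
      (min_le_right _ _).trans (min_le_left _ _), (min_le_right _ _).trans (min_le_right _ _)⟩
  refine ⟨η, hη, fun E' haff' hclose => ?_⟩
  have hfwd := H E' E haff (fun φ hφ L hL => (hclose φ hφ L hL).trans hηη₀)
    (fun φ hφ L hL => (hK φ hφ L hL).trans (by linarith)) L₀ hL₀
    (fun j => (hσ j).trans (by linarith)) (fun j => by rw [hE₀ j, sub_self, abs_zero]; exact hη₀.le)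
    (fun v hv => hr (Metric.closedBall_subset_ball (by linarith) hv))
  -- The vectors attainable under `E'` form a convex set coming within `η` of each point of a ball
  -- attainable under `E`.
  have hball' : Metric.ball D.μE (r - η) ⊆
      {v : Fin p → ℝ | ∃ L ∈ 𝓛, ∀ j, v j = E' fun x => D.φE j x * L x} := by
    refine Convex.ball_subset_of_forall_exists_dist_le ?_ hη.le ?_
    · rintro v ⟨L, hL, hv⟩ v' ⟨L', hL', hv'⟩ s t hs ht hst
      refine ⟨s • L + t • L', h𝓛 hL hL' hs ht hst, fun j => ?_⟩
      rw [haff' _ (D.φE_mem j) L hL L' hL' s t hs ht hst, ← hv j, ← hv' j]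
      simp
    · intro v hv
      obtain ⟨L, hL, hLv⟩ := hr hv
      refine ⟨fun j => E' fun x => D.φE j x * L x, ⟨L, hL, fun j => rfl⟩, ?_⟩
      rw [dist_pi_le_iff hη.le]
      intro j
      rw [Real.dist_eq, hLv j]
      exact hclose _ (D.φE_mem j) L hL
  have hbwd := H E E' haff'
    (fun φ hφ L hL => by rw [abs_sub_comm]; exact (hclose φ hφ L hL).trans hηη₀)
    (fun φ hφ L hL => by
      have h1 := abs_le.1 (hclose φ hφ L hL)
      have h2 := abs_le.1 (hK φ hφ L hL)
      exact abs_le.2 ⟨by linarith, by linarith⟩) L₀ hL₀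
    (fun j => by
      have h1 := abs_le.1 (hclose _ (D.φI_mem j) L₀ hL₀)
      linarith [hσ j])
    (fun j => by
      rw [← hE₀ j]
      exact (hclose _ (D.φE_mem j) L₀ hL₀).trans hηη₀)
    (fun v hv => hball' (Metric.closedBall_subset_ball (by linarith) hv))
  have hle : ∀ E₁ E₂ : (S → ℝ) → ℝ, (∀ L ∈ D.feasible E₁ 𝓛, ∃ L' ∈ D.feasible E₂ 𝓛,
      D.objective E₁ L ≤ D.objective E₂ L' + ε) → D.val E₁ 𝓛 ≤ D.val E₂ 𝓛 + (ε : EReal) := by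
    intro E₁ E₂ h
    refine iSup₂_le fun L hL => ?_
    obtain ⟨L', hL', hLL'⟩ := h L hL
    calc ((D.objective E₁ L : ℝ) : EReal) ≤ ((D.objective E₂ L' + ε : ℝ) : EReal) :=
          EReal.coe_le_coe_iff.2 hLL'
      _ = (D.objective E₂ L' : EReal) + (ε : EReal) := EReal.coe_add _ _
      _ ≤ D.val E₂ 𝓛 + (ε : EReal) :=
          add_le_add_left (le_iSup₂ (f := fun L (_ : L ∈ D.feasible E₂ 𝓛) =>
            ((D.objective E₂ L : ℝ) : EReal)) L' hL') _
  have h1 := hle _ _ hfwd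
  have h2 := hle _ _ hbwd
  have hvK : D.val E 𝓛 ≤ (K : EReal) := iSup₂_le fun L hL =>
    EReal.coe_le_coe_iff.2 (abs_le.1 (hK _ D.φ₀_mem L hL.1)).2
  have hv0 : (D.objective E L₀ : EReal) ≤ D.val E 𝓛 :=
    le_iSup₂ (f := fun L (_ : L ∈ D.feasible E 𝓛) => ((D.objective E L : ℝ) : EReal)) L₀
      ⟨hL₀, fun j => (hI₀ j).le, hE₀⟩
  obtain ⟨v, hv⟩ : ∃ v : ℝ, D.val E 𝓛 = v := by
    refine ⟨(D.val E 𝓛).toReal, (EReal.coe_toReal ?_ ?_).symm⟩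
    · exact ne_top_of_le_ne_top (EReal.coe_ne_top K) hvK
    · exact ne_bot_of_le_ne_bot (EReal.coe_ne_bot _) hv0
  rw [hv] at h1 h2 ⊢
  obtain ⟨u, hu⟩ : ∃ u : ℝ, D.val E' 𝓛 = u := by
    refine ⟨(D.val E' 𝓛).toReal, (EReal.coe_toReal ?_ ?_).symm⟩
    · exact ne_top_of_le_ne_top (EReal.coe_ne_top (v + ε)) h1
    · intro h
      rw [h, EReal.bot_add] at h2
      exact EReal.coe_ne_bot v (le_bot_iff.1 h2)
  rw [hu] at h1 h2 ⊢
  rw [← EReal.coe_add, EReal.coe_le_coe_iff] at h1 h2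
  rw [← EReal.coe_sub, EReal.abs_def]
  exact ENNReal.ofReal_le_ofReal (abs_le.2 ⟨by linarith, by linarith⟩)

end MomentData

/-! ### Minimal measurable majorants and outer almost sure convergence -/

/-- Replace the superlevel sets of `T` at rational levels by measurable hulls, and take the infimum
of the levels whose hull misses `ω`. Minimality holds because a hull meets each measurable set in
the same measure as the original set does. -/
theorem exists_isMinMeasurableMajorant {Ω : Type*} [MeasurableSpace Ω] (P : Measure Ω)
    [IsFiniteMeasure P] (T : Ω → ℝ≥0∞) : ∃ U, IsMinMeasurableMajorant P T U := by
  classical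
  let c : ℚ → ℝ≥0∞ := fun q => (Real.toNNReal q : ℝ≥0∞)
  let A : ℚ → Set Ω := fun q => toMeasurable P {ω | c q < T ω}
  refine ⟨fun ω => ⨅ q, if ω ∈ A q then ⊤ else c q, ?_, fun ω => ?_, fun V hV hTV => ?_⟩
  · exact Measurable.iInf fun q =>
      Measurable.ite (measurableSet_toMeasurable _ _) measurable_const measurable_const
  · refine le_iInf fun q => ?_
    split_ifs with h
    · exact le_top
    · exact not_lt.1 fun hlt => h (subset_toMeasurable P _ hlt)
  · have h : ∀ q, ∀ᵐ ω ∂P, ω ∈ A q → c q < V ω := fun q => by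
      have hm : MeasurableSet {ω | V ω ≤ c q} := measurableSet_le hV measurable_const
      have h0 : P (A q ∩ {ω | V ω ≤ c q}) = 0 := by
        rw [Measure.measure_toMeasurable_inter hm (measure_ne_top _ _)]
        refine measure_mono_null ?_ (ae_iff.1 hTV)
        rintro ω ⟨h1, h2⟩ h3
        exact absurd (lt_of_lt_of_le h1 h3) (not_lt.2 h2)
      rw [ae_iff]
      refine measure_mono_null ?_ h0
      intro ω hω
      have hω : ¬(ω ∈ A q → c q < V ω) := hω
      rw [Classical.not_imp, not_lt] at hω
      exact hω
    filter_upwards [ae_all_iff.2 h] with ω hω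
    refine le_of_forall_gt fun b hb => ?_
    obtain ⟨q, -, hq1, hq2⟩ := ENNReal.lt_iff_exists_rat_btwn.1 hb
    refine (iInf_le _ q).trans_lt ?_
    have : ω ∉ A q := fun hA => absurd (hω q hA) (not_lt.2 hq1.le)
    rw [if_neg this]
    exact hq2

/-- The function equal to `ε` on a measurable version of `A n` and `⊤` elsewhere is a measurable
majorant, so by minimality `U n ≤ ε` almost surely on `A n`. Then let `ε` run through `1 / (k + 1)`.
-/
theorem outerASTendsto_of_forall_pos {Ω : Type*} [MeasurableSpace Ω] {P : Measure Ω}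
    [IsFiniteMeasure P] {Y : ℕ → Ω → EReal} {c : EReal}
    (h : ∀ ε : ℝ, 0 < ε → ∃ A : ℕ → Set Ω, (∀ n, NullMeasurableSet (A n) P) ∧
      (∀ n, ∀ ω ∈ A n, (Y n ω - c).abs ≤ ENNReal.ofReal ε) ∧
      ∀ᵐ ω ∂P, ∀ᶠ n in atTop, ω ∈ A n) :
    OuterASTendsto P Y c := by
  classical
  choose U hU using fun n => exists_isMinMeasurableMajorant P fun ω => (Y n ω - c).abs
  refine ⟨U, hU, ?_⟩
  have key : ∀ k : ℕ, ∀ᵐ ω ∂P, ∀ᶠ n in atTop, U n ω ≤ ENNReal.ofReal (1 / ((k : ℝ) + 1)) := by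
    intro k
    obtain ⟨A, hA, hYA, hev⟩ := h (1 / ((k : ℝ) + 1)) (by positivity)
    choose A' hA'A hA'm hA' using fun n => (hA n).exists_measurable_subset_ae_eq
    have h1 : ∀ n, ∀ᵐ ω ∂P, U n ω ≤
        if ω ∈ A' n then ENNReal.ofReal (1 / ((k : ℝ) + 1)) else ⊤ := fun n => by
      refine (hU n).2.2 _ (Measurable.ite (hA'm n) measurable_const measurable_const)
        (Eventually.of_forall fun ω => ?_)
      split_ifs with hω
      · exact hYA n ω (hA'A n hω)
      · exact le_top
    filter_upwards [ae_all_iff.2 h1, ae_all_iff.2 fun n => (hA' n).mem_iff, hev] with ω h2 h3 h4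
    filter_upwards [h4] with n hn
    simpa [(h3 n).2 hn] using h2 n
  filter_upwards [ae_all_iff.2 key] with ω hω
  rw [ENNReal.tendsto_nhds_zero]
  intro ε hε
  have hlim : Tendsto (fun k : ℕ => ENNReal.ofReal (1 / ((k : ℝ) + 1))) atTop (𝓝 0) := by
    simpa using ENNReal.tendsto_ofReal (tendsto_one_div_add_atTop_nhds_zero_nat (𝕜 := ℝ))
  obtain ⟨k, hk⟩ := (ENNReal.tendsto_nhds_zero.1 hlim ε hε).exists
  filter_upwards [hω k] with n hn using hn.trans hk

/-! ### Strong law for a single test function -/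

section LawOfLargeNumbers

variable {Ω S : Type*} [MeasurableSpace Ω] [MeasurableSpace S] {P : Measure Ω} {Q : Measure S}
  {X : ℕ → Ω → S} {ψ : S → ℝ}

theorem aemeasurable_sampleMean (hX : ∀ i, Measurable (X i)) (hlaw : ∀ i, P.map (X i) = Q)
    (hψ : AEMeasurable ψ Q) (n : ℕ) :
    AEMeasurable (fun ω => sampleMean (fun i : Fin n => X i ω) ψ) P := by
  refine AEMeasurable.const_mul (Finset.aemeasurable_fun_sum _ fun i _ => ?_) _
  exact AEMeasurable.comp_measurable (by rwa [hlaw]) (hX i)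

theorem ae_tendsto_sampleMean [IsProbabilityMeasure P] (hX : ∀ i, Measurable (X i))
    (hindep : iIndepFun X P) (hlaw : ∀ i, P.map (X i) = Q) (hψ : Integrable ψ Q) :
    ∀ᵐ ω ∂P, Tendsto (fun n => sampleMean (fun i : Fin n => X i ω) ψ) atTop (𝓝 (expect Q ψ)) := by
  have hψX : ∀ i, AEMeasurable ψ (P.map (X i)) := fun i => by
    rw [hlaw]
    exact hψ.aemeasurable
  have h := strong_law_ae_real (μ := P) (fun i => ψ ∘ X i)
    (Integrable.comp_measurable (by rwa [hlaw]) (hX 0))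
    (fun i j hij => (hindep.indepFun hij).comp₀ (hX i).aemeasurable (hX j).aemeasurable
      (hψX i) (hψX j))
    (fun i => IdentDistrib.comp_of_aemeasurable
      ⟨(hX i).aemeasurable, (hX 0).aemeasurable, by rw [hlaw, hlaw]⟩ (hψX i))
  have hE : ∫ ω, (ψ ∘ X 0) ω ∂P = expect Q ψ := by
    rw [expect, ← hlaw 0, integral_map (hX 0).aemeasurable (hψX 0).aestronglyMeasurable]
    rfl
  rw [hE] at h
  filter_upwards [h] with ω hω
  refine hω.congr fun n => ?_
  rw [sampleMean, Finset.sum_range, div_eq_inv_mul, one_div]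
  rfl

end LawOfLargeNumbers

/-! ### Convexity, boundedness and measurability of the likelihood ratios -/

section ShapeClass

variable {d : ℕ} {a : Fin d → ℝ} {M γ : ℝ} {g₀ : Set.Ici a → ℝ}

theorem convex_likelihoodRatios_shapeClass (hpos : ∀ x, 0 < g₀ x) :
    Convex ℝ (likelihoodRatios (shapeClass a M γ g₀) g₀) := by
  intro L hL L' hL' s t hs ht hst
  rw [mem_likelihoodRatios_shapeClass_iff hpos] at *
  have e : ∀ x, (s • L + t • L') x * g₀ x = s * (L x * g₀ x) + t * (L' x * g₀ x) := fun x => by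
    simp only [Pi.add_apply, Pi.smul_apply, smul_eq_mul]
    ring
  simp only [e]
  refine ⟨fun x => ⟨?_, ?_⟩, fun x y hxy => ?_⟩
  · exact add_nonneg (mul_nonneg hs (hL.1 x).1) (mul_nonneg ht (hL'.1 x).1)
  · calc s * (L x * g₀ x) + t * (L' x * g₀ x)
        ≤ s * (M * g₀ x) ^ (1 / (1 - γ)) + t * (M * g₀ x) ^ (1 / (1 - γ)) :=
          add_le_add (mul_le_mul_of_nonneg_left (hL.1 x).2 hs)
            (mul_le_mul_of_nonneg_left (hL'.1 x).2 ht)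
      _ = (M * g₀ x) ^ (1 / (1 - γ)) := by rw [← add_mul, hst, one_mul]
  · exact add_le_add (mul_le_mul_of_nonneg_left (hL.2 hxy) hs)
      (mul_le_mul_of_nonneg_left (hL'.2 hxy) ht)

/-- Dividing the envelope by `g₀` leaves a power of `g₀` with exponent `1 / (1 - γ) - 1 ≥ 0`, hence
largest at `a`. -/
theorem likelihoodRatio_le (hM : 0 < M) (hγ : γ ∈ Set.Ioo (0 : ℝ) 1) (hpos : ∀ x, 0 < g₀ x)
    (hg : Antitone g₀) {L : Set.Ici a → ℝ}
    (hL : L ∈ likelihoodRatios (shapeClass a M γ g₀) g₀) (x : Set.Ici a) :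
    L x ≤ M ^ (1 / (1 - γ)) * g₀ ⟨a, Set.self_mem_Ici⟩ ^ (1 / (1 - γ) - 1) := by
  have hx := (((mem_likelihoodRatios_shapeClass_iff hpos).1 hL).1 x).2
  have h1 : 0 < 1 - γ := by linarith [hγ.2]
  have h2 : 0 ≤ 1 / (1 - γ) - 1 := by
    rw [sub_nonneg, le_div_iff₀ h1]
    linarith [hγ.1]
  rw [← le_div_iff₀ (hpos x), Real.mul_rpow hM.le (hpos x).le, mul_div_assoc,
    ← Real.rpow_sub_one (hpos x).ne'] at hx
  exact hx.trans (mul_le_mul_of_nonneg_left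
    (Real.rpow_le_rpow (hpos x).le (hg x.2) h2) (Real.rpow_nonneg hM.le _))

theorem aemeasurable_likelihoodRatio (hpos : ∀ x, 0 < g₀ x) (hg : Antitone g₀)
    {L : Set.Ici a → ℝ} (hL : L ∈ likelihoodRatios (shapeClass a M γ g₀) g₀) :
    AEMeasurable L (lebesgueOn (Set.Ici a)) := by
  have hf := aemeasurable_of_antitone ((mem_likelihoodRatios_shapeClass_iff hpos).1 hL).2
  refine (hf.div (aemeasurable_of_antitone hg)).congr (Eventually.of_forall fun x => ?_)
  exact mul_div_cancel_right₀ _ (hpos x).ne'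

theorem likelihoodRatio_nonneg (hpos : ∀ x, 0 < g₀ x) {L : Set.Ici a → ℝ}
    (hL : L ∈ likelihoodRatios (shapeClass a M γ g₀) g₀) (x : Set.Ici a) : 0 ≤ L x :=
  nonneg_of_mul_nonneg_left (((mem_likelihoodRatios_shapeClass_iff hpos).1 hL).1 x).1 (hpos x)

end ShapeClass

theorem momentAffineOn_sampleMean {S : Type*} {n : ℕ} (x : Fin n → S) (φ : S → ℝ)
    (𝓛 : Set (S → ℝ)) : MomentAffineOn (sampleMean x) φ 𝓛 := by
  intro L _ L' _ s t _ _ _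
  rw [← sampleMean_const_mul, ← sampleMean_const_mul, ← sampleMean_add]
  congr 1
  funext y
  simp only [Pi.add_apply, Pi.smul_apply, smul_eq_mul]
  ring

theorem momentAffineOn_expect {S : Type*} [MeasurableSpace S] {P : Measure S} {φ : S → ℝ}
    {𝓛 : Set (S → ℝ)} (h : ∀ L ∈ 𝓛, Integrable (fun x => φ x * L x) P) :
    MomentAffineOn (expect P) φ 𝓛 := by
  intro L hL L' hL' s t _ _ _
  simp only [expect]
  rw [← integral_const_mul, ← integral_const_mul,
    ← integral_add ((h L hL).const_mul s) ((h L' hL').const_mul t)]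
  congr 1
  funext y
  simp only [Pi.add_apply, Pi.smul_apply, smul_eq_mul]
  ring

/-! ### Convergence of the optimal values -/

theorem outerASTendsto_val {d m p : ℕ} {a : Fin d → ℝ} {M γ : ℝ} (hM : 0 < M)
    (hγ : γ ∈ Set.Ioo (0 : ℝ) 1) {g₀ : Set.Ici a → ℝ} (hpos : ∀ x, 0 < g₀ x) (hg : Antitone g₀)
    (D : MomentData (Set.Ici a) m p)
    (hD : ∀ φ ∈ D.functions, Integrable φ (densityLaw g₀))
    (hSlater : D.Slater (expect (densityLaw g₀)) (likelihoodRatios (shapeClass a M γ g₀) g₀))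
    {Ω : Type*} [MeasurableSpace Ω] (P : Measure Ω) [IsProbabilityMeasure P]
    {X : ℕ → Ω → Set.Ici a} (hX : ∀ i, Measurable (X i)) (hindep : iIndepFun X P)
    (hlaw : ∀ i, P.map (X i) = densityLaw g₀) :
    OuterASTendsto P
      (fun n ω => D.val (sampleMean fun i : Fin n => X i ω)
        (likelihoodRatios (shapeClass a M γ g₀) g₀))
      (D.val (expect (densityLaw g₀)) (likelihoodRatios (shapeClass a M γ g₀) g₀)) := by
  classical
  have hprob : IsProbabilityMeasure (densityLaw g₀) := by
    rw [← hlaw 0]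
    exact Measure.isProbabilityMeasure_map (hX 0).aemeasurable
  set Q := densityLaw g₀ with hQ
  set 𝓛 := likelihoodRatios (shapeClass a M γ g₀) g₀ with h𝓛
  set o : Set.Ici a := ⟨a, Set.self_mem_Ici⟩ with ho
  have hQle : Q ≤ ENNReal.ofReal (g₀ o) • lebesgueOn (Set.Ici a) :=
    densityLaw_le fun x => hg x.2
  obtain ⟨C, hC, hLC⟩ : ∃ C : ℝ, 0 ≤ C ∧ ∀ L ∈ 𝓛, ∀ x, L x ≤ C :=
    ⟨M ^ (1 / (1 - γ)) * g₀ o ^ (1 / (1 - γ) - 1),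
      mul_nonneg (Real.rpow_nonneg hM.le _) (Real.rpow_nonneg (hpos o).le _),
      fun L hL => likelihoodRatio_le hM hγ hpos hg hL⟩
  have hL0 : ∀ L ∈ 𝓛, ∀ x, 0 ≤ L x := fun L hL => likelihoodRatio_nonneg hpos hL
  have hLm : ∀ L ∈ 𝓛, AEMeasurable L Q := fun L hL =>
    (aemeasurable_likelihoodRatio hpos hg hL).mono_ac (densityLaw_absolutelyContinuous g₀)
  have hLn : ∀ L ∈ 𝓛, ∀ x, ‖L x‖ ≤ C := fun L hL x => by
    rw [Real.norm_of_nonneg (hL0 L hL x)]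
    exact hLC L hL x
  have hφL : ∀ φ ∈ D.functions, ∀ L ∈ 𝓛, Integrable (fun x => φ x * L x) Q := fun φ hφ L hL =>
    (hD φ hφ).mul_bdd (hLm L hL).aestronglyMeasurable (Eventually.of_forall (hLn L hL))
  have hbdd : ∀ φ ∈ D.functions, ∃ K, ∀ L ∈ 𝓛, |expect Q fun x => φ x * L x| ≤ K :=
    fun φ hφ => ⟨∫ x, ‖φ x‖ * C ∂Q, fun L hL =>
      (norm_integral_le_of_norm_le (f := fun x => φ x * L x) ((hD φ hφ).norm.mul_const C)
        (Eventually.of_forall fun x => by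
          rw [norm_mul]
          exact mul_le_mul_of_nonneg_left (hLn L hL x) (norm_nonneg _)) :)⟩
  refine outerASTendsto_of_forall_pos fun ε hε => ?_
  obtain ⟨η, hη, hval⟩ := D.exists_val_sub_abs_le (convex_likelihoodRatios_shapeClass hpos)
    (fun φ hφ => momentAffineOn_expect (hφL φ hφ)) hbdd hSlater hε
  choose! T θ hθ hT hunif using fun φ (hφ : φ ∈ D.functions) =>
    exists_finset_uniform hpos hg hQle (hD φ hφ)
      (Real.rpow_nonneg (mul_pos hM (hpos o)).le (1 / (1 - γ))) hC hη
  have hfin : D.functions.Finite := ((Set.finite_range _).union (Set.finite_range _)).insert _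
  -- Finitely many sample means define this event, so it is null measurable and holds eventually
  -- almost surely; on it every moment is within `η`, uniformly over `𝓛`.
  refine ⟨fun n => {ω | ∀ φ ∈ D.functions, ∀ ψ ∈ T φ,
    |sampleMean (fun i : Fin n => X i ω) ψ - expect Q ψ| ≤ θ φ}, fun n => ?_, fun n ω hω => ?_, ?_⟩
  · have : {ω | ∀ φ ∈ D.functions, ∀ ψ ∈ T φ,
        |sampleMean (fun i : Fin n => X i ω) ψ - expect Q ψ| ≤ θ φ} =
        ⋂ φ ∈ D.functions, ⋂ ψ ∈ T φ,
          {ω | |sampleMean (fun i : Fin n => X i ω) ψ - expect Q ψ| ≤ θ φ} := by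
      ext ω
      simp
    beta_reduce
    rw [this]
    refine NullMeasurableSet.biInter hfin.countable fun φ hφ =>
      NullMeasurableSet.biInter (T φ).countable_toSet fun ψ hψ => ?_
    have hm := aemeasurable_sampleMean hX hlaw (hT φ hφ ψ hψ).aemeasurable n
    exact nullMeasurableSet_le (continuous_abs.measurable.comp_aemeasurable (hm.sub_const _))
      aemeasurable_const
  · refine hval _ (fun φ _ => momentAffineOn_sampleMean _ φ _) fun φ hφ L hL => ?_
    have hL' := (mem_likelihoodRatios_shapeClass_iff hpos).1 hL
    exact hunif φ hφ n _ (hω φ hφ) L (hLm L hL) (hL0 L hL) (hLC L hL) hL'.2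
      fun s => (hL'.1 s).2.trans (antitone_envelope hM hγ hpos hg s.2)
  · have h1 : ∀ᵐ ω ∂P, ∀ φ ∈ D.functions, ∀ ψ ∈ T φ,
        Tendsto (fun n => sampleMean (fun i : Fin n => X i ω) ψ) atTop (𝓝 (expect Q ψ)) :=
      (ae_ball_iff hfin.countable).2 fun φ hφ =>
        (ae_ball_iff (T φ).countable_toSet).2 fun ψ hψ =>
          ae_tendsto_sampleMean hX hindep hlaw (hT φ hφ ψ hψ)
    filter_upwards [h1] with ω hω
    refine (eventually_all_finite hfin).2 fun φ hφ =>
      (Filter.eventually_all_finset _).2 fun ψ hψ => ?_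
    filter_upwards [Metric.tendsto_nhds.1 (hω φ hφ ψ hψ) (θ φ) (hθ φ hφ)] with n hn
    exact hn.le

end IWSAA

theorem corollary5 {d m p : ℕ} (hd : 2 ≤ d) (a : Fin d → ℝ) (M γ : ℝ) (hM : 0 < M)
    (hγ : γ ∈ Set.Ioo (0 : ℝ) 1)
    (g₀ : Set.Ici a → ℝ) (hg₀_pos : ∀ x, 0 < g₀ x) (hg₀_ou : IWSAA.OrthounimodalAbout a g₀)
    (hg₀_density : ∫⁻ x, ENNReal.ofReal (g₀ x) ∂(IWSAA.lebesgueOn (Set.Ici a)) = 1)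
    (D : IWSAA.MomentData (Set.Ici a) m p) (δ : ℝ) (hδ : 0 < δ)
    (hφ₀ : MemLp D.φ₀ (ENNReal.ofReal (1 + δ)) (IWSAA.densityLaw g₀))
    (hφI : ∀ j, MemLp (D.φI j) (ENNReal.ofReal (1 + δ)) (IWSAA.densityLaw g₀))
    (hφE : ∀ j, MemLp (D.φE j) (ENNReal.ofReal (1 + δ)) (IWSAA.densityLaw g₀))
    (𝓛 : Set (Set.Ici a → ℝ))
    (h𝓛 : 𝓛 = IWSAA.likelihoodRatios (IWSAA.shapeClass a M γ g₀) g₀)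
    (hSlater : D.Slater (IWSAA.expect (IWSAA.densityLaw g₀)) 𝓛)
    {Ω : Type*} [MeasurableSpace Ω] (P : Measure Ω) [IsProbabilityMeasure P]
    (X : ℕ → Ω → Set.Ici a) (hX_meas : ∀ i, Measurable (X i)) (hX_indep : iIndepFun X P)
    (hX_law : ∀ i, P.map (X i) = IWSAA.densityLaw g₀) :
    (∀ (n : ℕ), 0 < n → ∀ x : Fin n → Set.Ici a,
      (fun (L : Set.Ici a → ℝ) (i : Fin n) => L (x i)) '' 𝓛 = IWSAA.discreteShape M γ g₀ x ∧
      (fun (L : Set.Ici a → ℝ) (i : Fin n) => L (x i)) '' D.feasible (IWSAA.sampleMean x) 𝓛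
        = (IWSAA.reducedLP D M γ g₀ x).feasible ∧
      (∀ L : Set.Ici a → ℝ, D.objective (IWSAA.sampleMean x) L
        = (IWSAA.reducedLP D M γ g₀ x).objective fun i => L (x i)) ∧
      D.val (IWSAA.sampleMean x) 𝓛 = (IWSAA.reducedLP D M γ g₀ x).val) ∧
    IWSAA.OuterASTendsto P
      (fun n ω => D.val (IWSAA.sampleMean fun i : Fin n => X i ω) 𝓛)
      (D.val (IWSAA.expect (IWSAA.densityLaw g₀)) 𝓛) := by
  have hg := IWSAA.orthounimodalAbout_self_iff_antitone.1 hg₀_ou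
  subst h𝓛
  refine ⟨fun n _ x => ⟨IWSAA.image_likelihoodRatios_eq_discreteShape hM hγ hg₀_pos hg x,
    IWSAA.image_feasible_eq hM hγ hg₀_pos hg D x, IWSAA.objective_sampleMean_eq D M γ g₀ x,
    IWSAA.val_sampleMean_eq hM hγ hg₀_pos hg D x⟩, ?_⟩
  have hprob : IsProbabilityMeasure (IWSAA.densityLaw g₀) := by
    rw [← hX_law 0]
    exact Measure.isProbabilityMeasure_map (hX_meas 0).aemeasurable
  -- Under a probability law, a finite moment of order `1 + δ` gives integrability.
  have hδ1 : 1 ≤ ENNReal.ofReal (1 + δ) := by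
    rw [ENNReal.one_le_ofReal]
    linarith
  refine IWSAA.outerASTendsto_val hM hγ hg₀_pos hg D ?_ hSlater P hX_meas hX_indep hX_law
  rintro φ (rfl | ⟨j, rfl⟩ | ⟨j, rfl⟩)
  · exact hφ₀.integrable hδ1
  · exact (hφI j).integrable hδ1
  · exact (hφE j).integrable hδ1
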